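/- **Setting and notation.** Let $n,p\ge 1$, $X\in\mathbb R^{n\times p}$ with spectral norm $\|X\|_2$, $\bar X=[X,\,I_n]$, and let $\bar\beta^*=(\beta^*,\gamma^*)\in\mathbb R^p\times\mathbb R^n$ be deterministic, so $\bar X\bar\beta^*=X\beta^*+\gamma^*$. Write $\mathcal J=\{j:\beta^*_j\neq 0\}$, $J=|\mathcal J|$, $s^*=\|\beta^*\|_0=J$, $o^*=\|\gamma^*\|_0$, where $\|\cdot\|_0$ is the number of nonzero coordinates. For a loss $l(\eta;y)$ that is differentiable in $\eta\in\mathbb R^n$ and random data $y$, the effective noise is $\epsilon=-\nabla l(\bar X\bar\beta^*;y)$. Let $\sigma>0$. The vector $\epsilon$ is assumed to be mean-zero sub-Gaussian with scale bounded by $\sigma$: every $\langle\epsilon,\alpha\rangle$, $\alpha\in\mathbb R^n$, has mean zero, sub-Gaussian tails, and $\inf\{c>0:\mathbb E\exp(\langle\epsilon,\alpha\rangle^2/c^2)\le 2\}\le\sigma\|\alpha\|_2$ (the coordinates may be dependent). Let $\vartheta\ge1$ be such that $q=\vartheta o^*$ is an integer, $\varrho>0$ with $\varrho\ge\|X\|_2$,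 $K\ge 0$, and $\lambda=A\sigma\sqrt{\log(ep)}$. An *A-estimator* is a pair $(\hat\beta,\hat\gamma)$, measurable in the underlying randomness, that is almost surely alternatively (block-coordinatewise) optimal for $\min l(X\beta+\gamma;y)+\lambda\varrho\|\beta\|_1$ subject to $\|\gamma\|_0\le q$: $\hat\beta\in\arg\min_\beta\, l(X\beta+\hat\gamma;y)+\lambda\varrho\|\beta\|_1$ and $\hat\gamma\in\arg\min_{\|\gamma\|_0\le q} l(X\hat\beta+\gamma;y)$. For all $\varepsilon,\delta>0$ there is $A_0>0$, and for every $A\ge A_0$ there is a constant $C>0$ ($A_0$ depends only on $\varepsilon,\delta$ and $C$ only on $\varepsilon,\delta,A$), such that the following two statements hold. **(i) Resistant lasso.** Let $l(\eta;y)=\|\eta-y\|_2^2/2$. Assume that at least one of the following two conditions holds for all $\beta\in\mathbb R^p$ and all $\gamma\in\mathbb R^n$ with $\|\gamma\|_0\le(1+\vartheta)o^*$: $$K\sqrt J\,\|X\beta+\gamma\|_2+\varrho\|\beta_{\mathcal J^c}\|_1\ \ge\ \frac{\|\gamma\|_2^2}{2\lambda\sqrt\vartheta}+(1+\varepsilon)\varrho\|\beta_{\mathcal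 J}\|_1,$$ $$\Big(1-\frac\delta2\Big)\|X\beta+\gamma\|_2^2+\lambda\varrho\|\beta_{\mathcal J^c}\|_1+K^2\lambda^2J\ \ge\ \frac{\|\gamma\|_2^2}{2\sqrt\vartheta}+(1+\varepsilon)\lambda\varrho\|\beta_{\mathcal J}\|_1 .$$ Then every A-estimator satisfies $$\mathbb E\big\|\bar X(\hat{\bar\beta}-\bar\beta^*)\big\|_2^2\ \le\ C\Big\{\sigma^2\vartheta o^*\log\frac{en}{o^*}+K^2\sigma^2s^*\log(ep)+\sigma^2\Big\},$$ where the first term is read as $0$ if $o^*=0$. **(ii) General loss.** The same risk bound holds for every A-estimator of any loss $l$ such that, almost surely, $l(\cdot\,;y)$ is differentiable with $1$-Lipschitz gradient and $$\big(2\bar\Delta_l-\delta D_2\big)(X\beta+\gamma,X\beta'+\gamma')+\lambda\varrho\|(\beta-\beta')_{\mathcal J^c}\|_1+K^2\lambda^2J\ \ge\ \frac{\|\gamma-\gamma'\|_2^2}{2\sqrt\vartheta}+(1+\varepsilon)\lambda\varrho\|(\beta-\beta')_{\mathcal J}\|_1$$ for all $\beta,\beta'\in\mathbb R^p$ and all $\gamma,\gamma'\in\mathbb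 R^n$ with $\|\gamma\|_0\le\vartheta o^*$, $\|\gamma'\|_0\le o^*$. Here $D_2(a,b)=\|a-b\|_2^2/2$, $\Delta_l(a,b)=l(a)-l(b)-\langle\nabla l(b),a-b\rangle$ and $\bar\Delta_l(a,b)=\{\Delta_l(a,b)+\Delta_l(b,a)\}/2$. -/

import Mathlib

open MeasureTheory

noncomputable section

namespace ResistantLasso

/-- `‖v‖₀`: the number of nonzero coordinates of `v`. -/
def l0norm {m : ℕ} (v : EuclideanSpace ℝ (Fin m)) : ℕ :=
  {i : Fin m | v i ≠ 0}.ncard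

/-- `‖v‖₁`. -/
def l1norm {m : ℕ} (v : EuclideanSpace ℝ (Fin m)) : ℝ := ∑ j, |v j|

open Classical in
/-- The support of `v`. -/
def supp {m : ℕ} (v : EuclideanSpace ℝ (Fin m)) : Finset (Fin m) :=
  Finset.univ.filter fun j => v j ≠ 0

/-- The spectral norm of a matrix. -/
def spectralNorm {n p : ℕ} (X : Matrix (Fin n) (Fin p) ℝ) : ℝ :=
  ‖(Matrix.toEuclideanLin X).toContinuousLinearMap‖

/-- The systematic component `[X, I] (β, γ) = X β + γ`. -/
def sysComp {n p : ℕ} (X : Matrix (Fin n) (Fin p) ℝ)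
    (β : EuclideanSpace ℝ (Fin p)) (γ : EuclideanSpace ℝ (Fin n)) : EuclideanSpace ℝ (Fin n) :=
  Matrix.toEuclideanLin X β + γ

/-- The generalized Bregman function `l a - l b - ⟨∇ l b, a - b⟩`. -/
def breg {n : ℕ} (l : EuclideanSpace ℝ (Fin n) → ℝ) (a b : EuclideanSpace ℝ (Fin n)) : ℝ :=
  l a - l b - inner ℝ (gradient l b) (a - b)

/-- The symmetrized generalized Bregman function. -/
def symBreg {n : ℕ} (l : EuclideanSpace ℝ (Fin n) → ℝ) (a b : EuclideanSpace ℝ (Fin n)) : ℝ :=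
  (breg l a b + breg l b a) / 2

/-- `‖a - b‖² / 2`, the Bregman function of half the squared norm. -/
def breg2 {n : ℕ} (a b : EuclideanSpace ℝ (Fin n)) : ℝ := ‖a - b‖ ^ 2 / 2

/-- The loss is differentiable and its gradient is `1`-Lipschitz. -/
def OneSmooth {n : ℕ} (l : EuclideanSpace ℝ (Fin n) → ℝ) : Prop :=
  Differentiable ℝ l ∧ ∀ a b, ‖gradient l a - gradient l b‖ ≤ ‖a - b‖

/-- The squared error loss `‖η - y‖² / 2`. -/
def sqLoss {n : ℕ} (η y : EuclideanSpace ℝ (Fin n)) : ℝ := ‖η - y‖ ^ 2 / 2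

/-- `(β, γ)` is alternatively optimal for
`min l (X β + γ) + lam * ρ * ‖β‖₁` subject to `‖γ‖₀ ≤ q`:
`β` is a global minimizer given `γ`, and `γ` is one given `β`. -/
def IsAEstimator {n p : ℕ} (l : EuclideanSpace ℝ (Fin n) → ℝ) (X : Matrix (Fin n) (Fin p) ℝ)
    (lam ρ : ℝ) (q : ℕ) (β : EuclideanSpace ℝ (Fin p)) (γ : EuclideanSpace ℝ (Fin n)) : Prop :=
  (∀ β' : EuclideanSpace ℝ (Fin p),
    l (sysComp X β γ) + lam * ρ * l1norm β ≤ l (sysComp X β' γ) + lam * ρ * l1norm β') ∧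
  l0norm γ ≤ q ∧
  ∀ γ' : EuclideanSpace ℝ (Fin n), l0norm γ' ≤ q → l (sysComp X β γ) ≤ l (sysComp X β γ')

/-- The scale (`ψ₂`-norm) `inf {c > 0 : E exp (ξ² / c²) ≤ 2}`, equal to `⊤` if there is no such
`c`. -/
def psi2Norm {Ω : Type*} [MeasurableSpace Ω] (ξ : Ω → ℝ) (μ : Measure Ω) : ENNReal :=
  ⨅ (c : ℝ) (_ : 0 < c)
    (_ : ∫⁻ ω, ENNReal.ofReal (Real.exp (ξ ω ^ 2 / c ^ 2)) ∂μ ≤ 2), ENNReal.ofReal c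

/-- A mean zero random variable with sub-Gaussian tails. -/
def IsSubGaussian {Ω : Type*} [MeasurableSpace Ω] (ξ : Ω → ℝ) (μ : Measure Ω) : Prop :=
  AEMeasurable ξ μ ∧ Integrable ξ μ ∧ ∫ ω, ξ ω ∂μ = 0 ∧
  ∃ C c : ℝ, 0 < C ∧ 0 < c ∧ ∀ t : ℝ, 0 < t →
    μ {ω | t ≤ |ξ ω|} ≤ ENNReal.ofReal (C * Real.exp (-c * t ^ 2))

/-- A mean zero sub-Gaussian random vector with scale bounded by `σ`; its coordinates may be
dependent. -/
def IsSubGaussianVec {Ω : Type*} [MeasurableSpace Ω] {n : ℕ}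
    (ε : Ω → EuclideanSpace ℝ (Fin n)) (σ : ℝ) (μ : Measure Ω) : Prop :=
  ∀ α : EuclideanSpace ℝ (Fin n),
    IsSubGaussian (fun ω => inner ℝ (ε ω) α) μ ∧
    psi2Norm (fun ω => inner ℝ (ε ω) α) μ ≤ ENNReal.ofReal (σ * ‖α‖)

/-- The effective noise `-∇ l (X β* + γ*; y)`. -/
def effectiveNoise {n p : ℕ} (l : EuclideanSpace ℝ (Fin n) → ℝ) (X : Matrix (Fin n) (Fin p) ℝ)
    (βs : EuclideanSpace ℝ (Fin p)) (γs : EuclideanSpace ℝ (Fin n)) : EuclideanSpace ℝ (Fin n) :=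
  -gradient l (sysComp X βs γs)

/-- The compatibility condition for the squared error loss. Here `J = supp βs` is the support of
the true coefficient vector and `o` the number of outliers. -/
def LassoCondition {n p : ℕ} (X : Matrix (Fin n) (Fin p) ℝ) (βs : EuclideanSpace ℝ (Fin p))
    (o : ℕ) (lam ρ θ ε K : ℝ) : Prop :=
  ∀ (β : EuclideanSpace ℝ (Fin p)) (γ : EuclideanSpace ℝ (Fin n)),
    (l0norm γ : ℝ) ≤ (1 + θ) * o →
    ‖γ‖ ^ 2 / (2 * lam * √θ) + (1 + ε) * ρ * ∑ j ∈ supp βs, |β j| ≤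
      K * √((supp βs).card : ℝ) * ‖sysComp X β γ‖ + ρ * ∑ j ∈ (supp βs)ᶜ, |β j|

/-- The additive form of the compatibility condition for the squared error loss. Unlike
`LassoCondition`, it is quadratic in `γ` on both sides, so that it can hold with `0 < o`. -/
def LassoQuadCondition {n p : ℕ} (X : Matrix (Fin n) (Fin p) ℝ) (βs : EuclideanSpace ℝ (Fin p))
    (o : ℕ) (lam ρ θ ε δ K : ℝ) : Prop :=
  ∀ (β : EuclideanSpace ℝ (Fin p)) (γ : EuclideanSpace ℝ (Fin n)),
    (l0norm γ : ℝ) ≤ (1 + θ) * o →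
    ‖γ‖ ^ 2 / (2 * √θ) + (1 + ε) * lam * ρ * ∑ j ∈ supp βs, |β j| ≤
      (1 - δ / 2) * ‖sysComp X β γ‖ ^ 2 + lam * ρ * ∑ j ∈ (supp βs)ᶜ, |β j|
        + K ^ 2 * lam ^ 2 * (supp βs).card

/-- The regularity condition for a general loss. Here `J = supp βs` is the support of the true
coefficient vector and `o` the number of outliers. -/
def GeneralCondition {n p : ℕ} (l : EuclideanSpace ℝ (Fin n) → ℝ)
    (X : Matrix (Fin n) (Fin p) ℝ) (βs : EuclideanSpace ℝ (Fin p))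
    (o : ℕ) (lam ρ θ ε δ K : ℝ) : Prop :=
  ∀ (β β' : EuclideanSpace ℝ (Fin p)) (γ γ' : EuclideanSpace ℝ (Fin n)),
    (l0norm γ : ℝ) ≤ θ * o → l0norm γ' ≤ o →
    ‖γ - γ'‖ ^ 2 / (2 * √θ) + (1 + ε) * lam * ρ * ∑ j ∈ supp βs, |β j - β' j| ≤
      2 * symBreg l (sysComp X β γ) (sysComp X β' γ')
        - δ * breg2 (sysComp X β γ) (sysComp X β' γ')
        + lam * ρ * ∑ j ∈ (supp βs)ᶜ, |β j - β' j|
        + K ^ 2 * lam ^ 2 * (supp βs).card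

/-- The error rate
`σ² θ o log (e n / o) + K² σ² s log (e p) + σ²`, where `0 log (e n / 0)` is `0`. -/
def rate (n p o s : ℕ) (σ θ K : ℝ) : ℝ :=
  σ ^ 2 * θ * o * Real.log (Real.exp 1 * n / o)
    + K ^ 2 * σ ^ 2 * s * Real.log (Real.exp 1 * p) + σ ^ 2

end ResistantLasso

end

/-! The proof is an oracle inequality with one stochastic term. Write `Δ` for the error of the
systematic component. Optimality in `β` is a convex first order condition
(`inner_gradient_le_of_beta_optimal`). In `γ` the feasible set is not convex, but optimality over
`q`-sparse vectors gives a first order inequality up to the error `‖γ̂ - γ*‖² / (2√ϑ)`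
(`inner_le_of_quantile_threshold`), which is exactly the term that the regularity condition pays
for. Adding the two bounds the symmetrized Bregman function by `⟨ε, Δ⟩` plus penalties, and the
regularity condition turns this into a bound on `‖Δ‖²` (`norm_sq_le_of_inner_noise_le`). No
convexity of the loss is used: the Lipschitz gradient supplies the remaining estimates.

The term `⟨ε, Δ⟩` must be bounded although the lasso error is not sparse. A set `S` of columns is
chosen to maximize a penalized squared projection of the noise. The projected part is handled by
Cauchy–Schwarz; the residual is nearly orthogonal to every column, so its contribution is a small
multiple of the `ℓ¹` penalty (`exists_modelSpace_inner_le`). Maximality also bounds the size of `S`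
by the projected noise, which removes `S` from the final bound once `A` is large.

Since `S` and the support of the outlier error are random, the projections are controlled over all
model spaces at once, in expectation, by a sum of penalized exponentials
(`lintegral_noiseExcess_le`). Its terms come from an exponential moment of projected sub-Gaussian
noise, valid for dependent coordinates (`lintegral_exp_norm_starProjection_sq_le`). Part (i) is part
(ii) for the squared loss (`generalCondition_sqLoss`). -/

namespace ResistantLasso

/-! ### Exponential moments of projected sub-Gaussian noise. -/

section Probability

open ProbabilityTheory

/-- The linear term vanishes after integrating a centered variable, leaving only the exponential of
the square, which the `ψ₂` scale controls. -/
theorem exp_le_add_exp_sq (x : ℝ) : Real.exp x ≤ x + Real.exp (x ^ 2) := by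
  have h2 : 1 + x ^ 2 ≤ Real.exp (x ^ 2) := by linarith [Real.add_one_le_exp (x ^ 2)]
  rcases le_or_gt |x| 1 with h | h
  · have := (abs_le.1 (Real.abs_exp_sub_one_sub_id_le h)).2
    linarith
  · rcases le_or_gt 0 x with hx | hx
    · rw [abs_of_nonneg hx] at h
      have : Real.exp x ≤ Real.exp (x ^ 2) := Real.exp_le_exp.2 (by nlinarith)
      linarith
    · rw [abs_of_neg hx] at h
      have : Real.exp x ≤ 1 := Real.exp_le_one_iff.2 hx.le
      nlinarith

variable {Ω : Type*} [MeasurableSpace Ω] {μ : Measure Ω}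

/-- The sub-Gaussian hypothesis speaks only of scalar products with fixed vectors; this form reduces
both measurability and moments to them. -/
theorem norm_starProjection_sq_eq {n : ℕ} (V : Submodule ℝ (EuclideanSpace ℝ (Fin n)))
    (x : EuclideanSpace ℝ (Fin n)) :
    ‖V.starProjection x‖ ^ 2 =
      ∑ i, inner ℝ x (stdOrthonormalBasis ℝ V i : EuclideanSpace ℝ (Fin n)) ^ 2 := by
  have h := (stdOrthonormalBasis ℝ V).sum_sq_norm_inner_left (V.orthogonalProjectionOnto x)
  rw [Submodule.starProjection_apply, ← Submodule.coe_norm, ← h]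
  refine Finset.sum_congr rfl fun i _ => ?_
  rw [Submodule.inner_orthogonalProjectionOnto_eq_of_mem_right, Real.norm_eq_abs, sq_abs]

theorem aemeasurable_norm_starProjection_sq {n : ℕ} {e : Ω → EuclideanSpace ℝ (Fin n)} {σ : ℝ}
    (he : IsSubGaussianVec e σ μ) (V : Submodule ℝ (EuclideanSpace ℝ (Fin n))) :
    AEMeasurable (fun ω => ‖V.starProjection (e ω)‖ ^ 2) μ := by
  simp only [norm_starProjection_sq_eq]
  exact Finset.aemeasurable_fun_sum _ fun i _ => (he _).1.1.pow_const 2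

variable [IsProbabilityMeasure μ]

/-- The moment generating function of a centered variable is controlled by its `ψ₂` scale. -/
theorem lintegral_exp_le_of_psi2 {ξ : Ω → ℝ} (hm : AEMeasurable ξ μ) (hi : Integrable ξ μ)
    (h0 : ∫ ω, ξ ω ∂μ = 0) {c : ℝ} (hc : 0 < c)
    (h : ∫⁻ ω, ENNReal.ofReal (Real.exp (ξ ω ^ 2 / c ^ 2)) ∂μ ≤ 2) :
    ∫⁻ ω, ENNReal.ofReal (Real.exp (ξ ω)) ∂μ ≤ ENNReal.ofReal (Real.exp (c ^ 2)) := by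
  set Z : Ω → ℝ := fun ω => Real.exp (ξ ω ^ 2 / c ^ 2) with hZ
  have hZm : AEStronglyMeasurable Z μ :=
    (Real.measurable_exp.comp_aemeasurable ((hm.pow_const 2).div_const _)).aestronglyMeasurable
  have hZi : Integrable Z μ := by
    refine ⟨hZm, ?_⟩
    rw [hasFiniteIntegral_iff_ofReal (Filter.Eventually.of_forall fun ω => (Real.exp_pos _).le)]
    exact lt_of_le_of_lt h (by simp)
  have hZ2 : ∫ ω, Z ω ∂μ ≤ 2 := by
    rw [integral_eq_lintegral_of_nonneg_ae
      (Filter.Eventually.of_forall fun ω => (Real.exp_pos _).le) hZm]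
    exact ENNReal.toReal_le_of_le_ofReal (by norm_num) (by simpa using h)
  have key : ∀ F : Ω → ℝ, Integrable F μ → (∀ ω, Real.exp (ξ ω) ≤ F ω) →
      ∫ ω, F ω ∂μ ≤ Real.exp (c ^ 2) →
      ∫⁻ ω, ENNReal.ofReal (Real.exp (ξ ω)) ∂μ ≤ ENNReal.ofReal (Real.exp (c ^ 2)) := by
    intro F hF hle hint
    calc ∫⁻ ω, ENNReal.ofReal (Real.exp (ξ ω)) ∂μ ≤ ∫⁻ ω, ENNReal.ofReal (F ω) ∂μ :=
          lintegral_mono fun ω => ENNReal.ofReal_le_ofReal (hle ω)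
      _ = ENNReal.ofReal (∫ ω, F ω ∂μ) := (ofReal_integral_eq_lintegral_ofReal hF
          (Filter.Eventually.of_forall fun ω => (Real.exp_pos _).le.trans (hle ω))).symm
      _ ≤ _ := ENNReal.ofReal_le_ofReal hint
  have hconv : ∀ (s z : ℝ), 0 ≤ s → s ≤ 1 →
      Real.exp (s * z) ≤ (1 - s) + s * Real.exp z := by
    intro s z hs hs1
    have := convexOn_exp.2 (Set.mem_univ (0 : ℝ)) (Set.mem_univ z) (sub_nonneg.2 hs1) hs (by ring)
    simpa using this
  have hc2 : 0 < c ^ 2 := by positivity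
  rcases le_or_gt (c ^ 2) 1 with h1 | h1
  -- For small `c`, the chord bound `hconv` with `s = c²` gives expectation at most `(1 - c²) + 2c²
  -- = 1 + c² ≤ exp (c²)`.
  · refine key (fun ω => ξ ω + ((1 - c ^ 2) + c ^ 2 * Z ω))
      (hi.add ((integrable_const _).add (hZi.const_mul _))) (fun ω => ?_) ?_
    · have := hconv (c ^ 2) (ξ ω ^ 2 / c ^ 2) hc2.le h1
      rw [mul_div_cancel₀ _ hc2.ne'] at this
      linarith [exp_le_add_exp_sq (ξ ω)]
    · have hi' : Integrable (fun ω => (1 - c ^ 2) + c ^ 2 * Z ω) μ :=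
        (integrable_const _).add (hZi.const_mul _)
      rw [integral_add hi hi', integral_add (integrable_const _) (hZi.const_mul _),
        integral_const_mul, h0]
      simp only [integral_const, probReal_univ, one_smul]
      nlinarith [Real.add_one_le_exp (c ^ 2)]
  -- For large `c`, Young's inequality replaces centering: the expectation is at most `(3/2) exp
  -- (c²/2)`, and `3/2 ≤ 1 + c²/2 ≤ exp (c²/2)`.
  · refine key (fun ω => Real.exp (c ^ 2 / 2) * (1 / 2 + 1 / 2 * Z ω))
      (((integrable_const _).add (hZi.const_mul _)).const_mul _) (fun ω => ?_) ?_
    · have := hconv (1 / 2) (ξ ω ^ 2 / c ^ 2) (by norm_num) (by norm_num)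
      have h3 : ξ ω ≤ c ^ 2 / 2 + 1 / 2 * (ξ ω ^ 2 / c ^ 2) := by
        have : 0 ≤ (ξ ω / c - c) ^ 2 := sq_nonneg _
        have e : (ξ ω / c - c) ^ 2 = ξ ω ^ 2 / c ^ 2 - 2 * ξ ω + c ^ 2 := by field_simp; ring
        linarith
      calc Real.exp (ξ ω) ≤ Real.exp (c ^ 2 / 2 + 1 / 2 * (ξ ω ^ 2 / c ^ 2)) :=
            Real.exp_le_exp.2 h3
        _ = Real.exp (c ^ 2 / 2) * Real.exp (1 / 2 * (ξ ω ^ 2 / c ^ 2)) := Real.exp_add _ _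
        _ ≤ _ := by gcongr; linarith
    · rw [integral_const_mul, integral_add (integrable_const _) (hZi.const_mul _),
        integral_const_mul]
      simp only [integral_const, probReal_univ, one_smul]
      have e : Real.exp (c ^ 2) = Real.exp (c ^ 2 / 2) * Real.exp (c ^ 2 / 2) := by
        rw [← Real.exp_add]; ring_nf
      rw [e]
      gcongr
      linarith [Real.add_one_le_exp (c ^ 2 / 2)]

theorem lintegral_exp_inner_le {n : ℕ} {e : Ω → EuclideanSpace ℝ (Fin n)} {σ : ℝ} (hσ : 0 < σ)
    (he : IsSubGaussianVec e σ μ) (α : EuclideanSpace ℝ (Fin n)) :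
    ∫⁻ ω, ENNReal.ofReal (Real.exp (inner ℝ (e ω) α)) ∂μ ≤
      ENNReal.ofReal (Real.exp (4 * σ ^ 2 * ‖α‖ ^ 2)) := by
  rcases eq_or_ne α 0 with rfl | hα
  · simp
  have hα' : 0 < ‖α‖ := norm_pos_iff.2 hα
  obtain ⟨⟨hm, hi, h0, -⟩, hψ⟩ := he α
  -- The infimum defining the scale need not be attained, so the factor 2 makes room for an
  -- admissible `c`; it becomes the 4 in the exponent.
  have hlt : psi2Norm (fun ω => inner ℝ (e ω) α) μ < ENNReal.ofReal (2 * σ * ‖α‖) := by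
    refine lt_of_le_of_lt hψ ((ENNReal.ofReal_lt_ofReal_iff (by positivity)).2 ?_)
    nlinarith [mul_pos hσ hα']
  simp only [psi2Norm, iInf_lt_iff] at hlt
  obtain ⟨c, hc, h2, hlt⟩ := hlt
  have hcl : c < 2 * σ * ‖α‖ := (ENNReal.ofReal_lt_ofReal_iff (by positivity)).1 hlt
  refine (lintegral_exp_le_of_psi2 hm hi h0 hc h2).trans
    (ENNReal.ofReal_le_ofReal (Real.exp_le_exp.2 ?_))
  calc c ^ 2 ≤ (2 * σ * ‖α‖) ^ 2 := by gcongr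
    _ = _ := by ring

theorem lintegral_pi_gaussian_prod {d : ℕ} (f : Fin d → ℝ → ℝ) (hf : ∀ i x, 0 ≤ f i x)
    (hi : ∀ i, Integrable (f i) (gaussianReal 0 1)) :
    ∫⁻ g, ENNReal.ofReal (∏ i, f i (g i)) ∂(Measure.pi fun _ : Fin d => gaussianReal 0 1) =
      ENNReal.ofReal (∏ i, ∫ x, f i x ∂gaussianReal 0 1) := by
  rw [← integral_fintype_prod_eq_prod (μ := fun _ : Fin d => gaussianReal 0 1)]
  exact (ofReal_integral_eq_lintegral_ofReal (Integrable.fintype_prod hi)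
    (Filter.Eventually.of_forall fun g => Finset.prod_nonneg fun i _ => hf i _)).symm

theorem lintegral_pi_gaussian_exp_linear {d : ℕ} (a : Fin d → ℝ) :
    ∫⁻ g, ENNReal.ofReal (Real.exp (∑ i, a i * g i))
        ∂(Measure.pi fun _ : Fin d => gaussianReal 0 1) =
      ENNReal.ofReal (Real.exp (∑ i, a i ^ 2 / 2)) := by
  have := lintegral_pi_gaussian_prod (fun i x => Real.exp (a i * x)) (fun _ _ => (Real.exp_pos _).le)
    (fun i => integrable_exp_mul_gaussianReal (a i))
  simp only [Real.exp_sum]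
  rw [this]
  congr 1
  refine Finset.prod_congr rfl fun i _ => ?_
  have h := congrFun (mgf_fun_id_gaussianReal (μ := 0) (v := 1)) (a i)
  simpa [mgf] using h

theorem integrable_and_integral_gaussian_exp_sq :
    Integrable (fun x : ℝ => Real.exp (x ^ 2 / 4)) (gaussianReal 0 1) ∧
      ∫ x, Real.exp (x ^ 2 / 4) ∂gaussianReal 0 1 ≤ Real.exp 1 := by
  have e : ∀ x : ℝ, gaussianPDFReal 0 1 x * Real.exp (x ^ 2 / 4) =
      (√(2 * Real.pi))⁻¹ * Real.exp (-(1 / 4) * x ^ 2) := by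
    intro x
    simp only [gaussianPDFReal, NNReal.coe_one, mul_one, sub_zero]
    rw [mul_assoc, ← Real.exp_add]
    ring_nf
  constructor
  · rw [gaussianReal_of_var_ne_zero 0 one_ne_zero,
      integrable_withDensity_iff_integrable_smul' (measurable_gaussianPDF 0 1)
        (Filter.Eventually.of_forall fun x => gaussianPDF_lt_top)]
    simp only [toReal_gaussianPDF, smul_eq_mul, e]
    exact (integrable_exp_neg_mul_sq (by norm_num)).const_mul _
  · rw [integral_gaussianReal_eq_integral_smul one_ne_zero]
    simp only [smul_eq_mul, e]
    rw [integral_const_mul, integral_gaussian]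
    have : √(Real.pi / (1 / 4)) ≤ √(2 * Real.pi) * 2 := by
      rw [show Real.pi / (1 / 4) = 2 ^ 2 * Real.pi by ring, Real.sqrt_mul (by norm_num),
        Real.sqrt_sq (by norm_num)]
      have : √Real.pi ≤ √(2 * Real.pi) := Real.sqrt_le_sqrt (by linarith [Real.pi_pos])
      linarith
    have hp : 0 < √(2 * Real.pi) := Real.sqrt_pos.2 (by positivity)
    calc (√(2 * Real.pi))⁻¹ * √(Real.pi / (1 / 4)) ≤ (√(2 * Real.pi))⁻¹ * (√(2 * Real.pi) * 2) := by
          gcongr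
      _ = 2 := by field_simp
      _ ≤ _ := by linarith [Real.add_one_le_exp (1 : ℝ)]

theorem lintegral_pi_gaussian_exp_sq_le (d : ℕ) :
    ∫⁻ g, ENNReal.ofReal (Real.exp (∑ i, g i ^ 2 / 4))
        ∂(Measure.pi fun _ : Fin d => gaussianReal 0 1) ≤ ENNReal.ofReal (Real.exp d) := by
  have := lintegral_pi_gaussian_prod (d := d) (fun _ x => Real.exp (x ^ 2 / 4))
    (fun _ _ => (Real.exp_pos _).le) (fun _ => integrable_and_integral_gaussian_exp_sq.1)
  simp only [Real.exp_sum]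
  rw [this]
  refine ENNReal.ofReal_le_ofReal ?_
  rw [Finset.prod_const, Finset.card_univ, Fintype.card_fin,
    show Real.exp d = Real.exp 1 ^ d by rw [← Real.exp_nat_mul, mul_one]]
  exact pow_le_pow_left₀ (integral_nonneg fun x => (Real.exp_pos _).le)
    integrable_and_integral_gaussian_exp_sq.2 d

/-- Exponential moment of the squared norm of the coordinates of a sub-Gaussian vector along an
orthonormal family, by linearization with an independent Gaussian vector. -/
theorem lintegral_exp_sum_inner_sq_le {n d : ℕ} {e : Ω → EuclideanSpace ℝ (Fin n)} {σ : ℝ}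
    (hσ : 0 < σ) (he : IsSubGaussianVec e σ μ) (u : Fin d → EuclideanSpace ℝ (Fin n))
    (hu : Orthonormal ℝ u) :
    ∫⁻ ω, ENNReal.ofReal (Real.exp ((∑ i, inner ℝ (e ω) (u i) ^ 2) / (32 * σ ^ 2))) ∂μ ≤
      ENNReal.ofReal (Real.exp d) := by
  set Γ : Measure (Fin d → ℝ) := Measure.pi fun _ : Fin d => gaussianReal 0 1
  -- Here `s² / 2 = 1 / (32σ²)` makes the Gaussian average reproduce the left side, while `4σ² s² =
  -- 1/4` keeps the remaining Gaussian integral of `exp (g² / 4)` finite.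
  set s : ℝ := (4 * σ)⁻¹ with hs
  have h1 : ∀ ω, ENNReal.ofReal (Real.exp ((∑ i, inner ℝ (e ω) (u i) ^ 2) / (32 * σ ^ 2))) =
      ∫⁻ g, ENNReal.ofReal (Real.exp (∑ i, s * inner ℝ (e ω) (u i) * g i)) ∂Γ := by
    intro ω
    rw [lintegral_pi_gaussian_exp_linear, Finset.sum_div]
    congr 3
    ext i
    rw [hs]
    field_simp
    ring
  have h2 : ∀ g : Fin d → ℝ, ∫⁻ ω, ENNReal.ofReal
      (Real.exp (∑ i, s * inner ℝ (e ω) (u i) * g i)) ∂μ ≤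
      ENNReal.ofReal (Real.exp (∑ i, g i ^ 2 / 4)) := by
    intro g
    have h := lintegral_exp_inner_le hσ he (∑ i, (s * g i) • u i)
    have hn : ‖∑ i, (s * g i) • u i‖ ^ 2 = ∑ i, (s * g i) ^ 2 := by
      rw [← real_inner_self_eq_norm_sq, hu.inner_sum]
      simp [sq]
    rw [hn] at h
    have e1 : 4 * σ ^ 2 * ∑ i, (s * g i) ^ 2 = ∑ i, g i ^ 2 / 4 := by
      rw [Finset.mul_sum]
      refine Finset.sum_congr rfl fun i _ => ?_
      rw [hs]
      field_simp
    rw [e1] at h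
    refine le_trans (le_of_eq ?_) h
    congr 1
    ext ω
    rw [inner_sum]
    simp only [inner_smul_right]
    refine congrArg _ (congrArg _ (Finset.sum_congr rfl fun i _ => ?_))
    ring
  simp only [h1]
  rw [lintegral_lintegral_swap]
  · exact (lintegral_mono h2).trans (lintegral_pi_gaussian_exp_sq_le d)
  · refine (Real.measurable_exp.comp_aemeasurable ?_).ennreal_ofReal
    refine Finset.aemeasurable_fun_sum _ fun i _ => ?_
    refine ((((he (u i)).1.1.comp_fst)).const_mul s).mul ?_
    exact ((measurable_pi_apply i).comp measurable_snd).aemeasurable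

theorem lintegral_exp_norm_starProjection_sq_le {n : ℕ} {e : Ω → EuclideanSpace ℝ (Fin n)} {σ : ℝ}
    (hσ : 0 < σ) (he : IsSubGaussianVec e σ μ) (V : Submodule ℝ (EuclideanSpace ℝ (Fin n))) :
    ∫⁻ ω, ENNReal.ofReal (Real.exp (‖V.starProjection (e ω)‖ ^ 2 / (32 * σ ^ 2))) ∂μ ≤
      ENNReal.ofReal (Real.exp (Module.finrank ℝ V)) := by
  simp only [norm_starProjection_sq_eq]
  refine lintegral_exp_sum_inner_sq_le hσ he
    (fun i => (stdOrthonormalBasis ℝ V i : EuclideanSpace ℝ (Fin n))) ?_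
  exact (stdOrthonormalBasis ℝ V).orthonormal.comp_linearIsometry V.subtypeₗᵢ

end Probability

/-! ### Smooth losses and the optimality conditions of an A-estimator. -/

section Deterministic

theorem mem_supp {m : ℕ} {v : EuclideanSpace ℝ (Fin m)} {i : Fin m} : i ∈ supp v ↔ v i ≠ 0 := by
  simp [supp]

theorem l0norm_eq_card_supp {m : ℕ} (v : EuclideanSpace ℝ (Fin m)) : l0norm v = (supp v).card := by
  rw [l0norm, ← Set.ncard_coe_finset]
  congr 1
  ext i
  simp [mem_supp]

theorem l0norm_le_card {m : ℕ} {v : EuclideanSpace ℝ (Fin m)} {s : Finset (Fin m)}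
    (h : ∀ i, v i ≠ 0 → i ∈ s) : l0norm v ≤ s.card := by
  rw [l0norm_eq_card_supp]
  exact Finset.card_le_card fun i hi => h i (mem_supp.1 hi)

theorem l0norm_smul_le {m : ℕ} (c : ℝ) (v : EuclideanSpace ℝ (Fin m)) :
    l0norm (c • v) ≤ l0norm v := by
  rw [l0norm_eq_card_supp v]
  refine l0norm_le_card fun i hi => mem_supp.2 fun h => hi ?_
  simp [h]

theorem supp_sub_subset {m : ℕ} (v w : EuclideanSpace ℝ (Fin m)) :
    supp (v - w) ⊆ supp v ∪ supp w := by
  intro i hi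
  rw [mem_supp] at hi
  by_contra h
  simp only [Finset.mem_union, mem_supp, not_or, not_not] at h
  exact hi (by simp [h.1, h.2])

theorem l0norm_sub_le {m : ℕ} (v w : EuclideanSpace ℝ (Fin m)) :
    l0norm (v - w) ≤ l0norm v + l0norm w := by
  simp only [l0norm_eq_card_supp]
  exact (Finset.card_le_card (supp_sub_subset v w)).trans (Finset.card_union_le _ _)

theorem sysComp_sub {n p : ℕ} (X : Matrix (Fin n) (Fin p) ℝ)
    (β β' : EuclideanSpace ℝ (Fin p)) (γ γ' : EuclideanSpace ℝ (Fin n)) :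
    sysComp X β γ - sysComp X β' γ' = sysComp X (β - β') (γ - γ') := by
  simp only [sysComp, map_sub]
  abel

theorem sysComp_smul {n p : ℕ} (X : Matrix (Fin n) (Fin p) ℝ) (c : ℝ)
    (β : EuclideanSpace ℝ (Fin p)) (γ : EuclideanSpace ℝ (Fin n)) :
    sysComp X (c • β) (c • γ) = c • sysComp X β γ := by
  simp only [sysComp, map_smul, smul_add]

/-- The loss values cancel on symmetrizing, so only gradients remain and the Lipschitz bound applies
directly. -/
theorem two_mul_symBreg {n : ℕ} (l : EuclideanSpace ℝ (Fin n) → ℝ)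
    (a b : EuclideanSpace ℝ (Fin n)) :
    2 * symBreg l a b = inner ℝ (gradient l a - gradient l b) (a - b) := by
  have h : inner ℝ (gradient l a) (b - a) = -inner ℝ (gradient l a) (a - b) := by
    rw [← inner_neg_right, neg_sub]
  simp only [symBreg, breg, inner_sub_left, h]
  ring

theorem OneSmooth.abs_two_mul_symBreg_le {n : ℕ} {l : EuclideanSpace ℝ (Fin n) → ℝ}
    (hl : OneSmooth l) (a b : EuclideanSpace ℝ (Fin n)) :
    |2 * symBreg l a b| ≤ ‖a - b‖ ^ 2 := by
  rw [two_mul_symBreg, sq]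
  refine (abs_real_inner_le_norm _ _).trans ?_
  gcongr
  exact hl.2 a b

/-- The quadratic upper bound for a function with a `1`-Lipschitz gradient. -/
theorem OneSmooth.le_add_inner_add {n : ℕ} {l : EuclideanSpace ℝ (Fin n) → ℝ}
    (hl : OneSmooth l) (a d : EuclideanSpace ℝ (Fin n)) :
    l (a + d) ≤ l a + inner ℝ (gradient l a) d + ‖d‖ ^ 2 / 2 := by
  set φ : ℝ → ℝ := fun t => l (a + t • d) - t * inner ℝ (gradient l a) d - t ^ 2 / 2 * ‖d‖ ^ 2
  have hline : ∀ t : ℝ, HasDerivAt (fun t : ℝ => a + t • d) d t := fun t => by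
    simpa using ((hasDerivAt_id t).smul_const d).const_add a
  have hφ : ∀ t : ℝ, HasDerivAt φ (inner ℝ (gradient l (a + t • d)) d -
      inner ℝ (gradient l a) d - t * ‖d‖ ^ 2) t := fun t => by
    have h1 : HasDerivAt (fun t : ℝ => l (a + t • d)) (inner ℝ (gradient l (a + t • d)) d) t := by
      have h := ((hl.1 (a + t • d)).hasGradientAt.hasFDerivAt).comp_hasDerivAt t (hline t)
      exact h.congr_deriv (by simp)
    have h2 : HasDerivAt (fun t : ℝ => t * inner ℝ (gradient l a) d)
        (inner ℝ (gradient l a) d) t := by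
      simpa using (hasDerivAt_id t).mul_const (inner ℝ (gradient l a) d)
    have h3 : HasDerivAt (fun t : ℝ => t ^ 2 / 2 * ‖d‖ ^ 2) (t * ‖d‖ ^ 2) t := by
      have := (((hasDerivAt_id t).pow 2).div_const 2).mul_const (‖d‖ ^ 2)
      convert! this using 1
      simp
    exact (h1.sub h2).sub h3
  have hanti : AntitoneOn φ (Set.Icc 0 1) := by
    refine antitoneOn_of_deriv_nonpos (convex_Icc 0 1)
      (fun t _ => (hφ t).continuousAt.continuousWithinAt)
      (fun t _ => (hφ t).differentiableAt.differentiableWithinAt) fun t ht => ?_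
    rw [interior_Icc] at ht
    rw [(hφ t).deriv, ← inner_sub_left]
    have h1 := real_inner_le_norm (gradient l (a + t • d) - gradient l a) d
    have h2 := hl.2 (a + t • d) a
    rw [add_sub_cancel_left, norm_smul, Real.norm_of_nonneg ht.1.le] at h2
    nlinarith [norm_nonneg d]
  have := hanti (Set.left_mem_Icc.2 zero_le_one) (Set.right_mem_Icc.2 zero_le_one) zero_le_one
  simp only [φ, one_smul, zero_smul, add_zero] at this
  linarith

theorem hasGradientAt_sqLoss {n : ℕ} (y η : EuclideanSpace ℝ (Fin n)) :
    HasGradientAt (fun η => sqLoss η y) (η - y) η := by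
  rw [hasGradientAt_iff_hasFDerivAt]
  have h := (((hasFDerivAt_id η).sub_const y).norm_sq).const_mul (1 / 2 : ℝ)
  have e : (fun η => sqLoss η y) = fun η => 1 / 2 * ‖id η - y‖ ^ 2 := by
    ext; simp [sqLoss]; ring
  rw [e]
  refine h.congr_fderiv ?_
  ext v
  simp

theorem oneSmooth_sqLoss {n : ℕ} (y : EuclideanSpace ℝ (Fin n)) :
    OneSmooth fun η => sqLoss η y := by
  refine ⟨fun η => (hasGradientAt_sqLoss y η).differentiableAt, fun a b => ?_⟩
  rw [(hasGradientAt_sqLoss y a).gradient, (hasGradientAt_sqLoss y b).gradient, sub_sub_sub_cancel_right]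

theorem two_mul_symBreg_sqLoss {n : ℕ} (y a b : EuclideanSpace ℝ (Fin n)) :
    2 * symBreg (fun η => sqLoss η y) a b = ‖a - b‖ ^ 2 := by
  rw [two_mul_symBreg, (hasGradientAt_sqLoss y a).gradient, (hasGradientAt_sqLoss y b).gradient,
    sub_sub_sub_cancel_right, real_inner_self_eq_norm_sq]

theorem l1norm_convex {m : ℕ} (v w : EuclideanSpace ℝ (Fin m)) {t : ℝ} (h0 : 0 ≤ t) (h1 : t ≤ 1) :
    l1norm (v + t • (w - v)) ≤ (1 - t) * l1norm v + t * l1norm w := by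
  simp only [l1norm, Finset.mul_sum, ← Finset.sum_add_distrib]
  refine Finset.sum_le_sum fun j _ => ?_
  have e : (v + t • (w - v)) j = (1 - t) * v j + t * w j := by simp; ring
  rw [e]
  refine (abs_add_le _ _).trans (le_of_eq ?_)
  rw [abs_mul, abs_mul, abs_of_nonneg h0, abs_of_nonneg (sub_nonneg.2 h1)]

/-- Dividing by `t` and letting `t` decrease to 0 shows this; it extracts a first order condition
from small steps towards a competitor. -/
theorem nonneg_of_forall_mul_add_sq_nonneg {a b : ℝ}
    (h : ∀ t : ℝ, 0 < t → t ≤ 1 → 0 ≤ t * a + t ^ 2 * b) :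
    0 ≤ a := by
  by_contra! ha
  have hb : 0 < |b| + 1 - a := by linarith [abs_nonneg b]
  have ht : 0 < -a / (|b| + 1 - a) := div_pos (by linarith) hb
  have hlt : -a / (|b| + 1 - a) < 1 := by
    rw [div_lt_one hb]
    linarith [abs_nonneg b]
  set t := -a / (|b| + 1 - a) with htd
  have hta : t * (|b| + 1 - a) = -a := div_mul_cancel₀ _ hb.ne'
  have h2 := h t ht hlt.le
  have h3 : 0 ≤ a + t * b := by
    by_contra! h4
    nlinarith
  nlinarith [mul_le_mul_of_nonneg_left (le_abs_self b) ht.le, mul_pos ht hb]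

variable {n p : ℕ} {l : EuclideanSpace ℝ (Fin n) → ℝ} {X : Matrix (Fin n) (Fin p) ℝ}

/-- The first order condition in `β`. -/
theorem inner_gradient_le_of_beta_optimal (hl : OneSmooth l) {κ : ℝ} (hκ : 0 ≤ κ)
    {β : EuclideanSpace ℝ (Fin p)} {γ : EuclideanSpace ℝ (Fin n)}
    (h : ∀ β' : EuclideanSpace ℝ (Fin p),
      l (sysComp X β γ) + κ * l1norm β ≤ l (sysComp X β' γ) + κ * l1norm β')
    (β' : EuclideanSpace ℝ (Fin p)) :
    inner ℝ (gradient l (sysComp X β γ)) (Matrix.toEuclideanLin X (β - β')) ≤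
      κ * (l1norm β' - l1norm β) := by
  set d := Matrix.toEuclideanLin X (β' - β) with hd
  have hneg : Matrix.toEuclideanLin X (β - β') = -d := by rw [hd, ← map_neg, neg_sub]
  rw [hneg, inner_neg_right]
  have := nonneg_of_forall_mul_add_sq_nonneg
    (a := inner ℝ (gradient l (sysComp X β γ)) d + κ * (l1norm β' - l1norm β))
    (b := ‖d‖ ^ 2 / 2) fun t ht ht1 => by
      have h1 := h (β + t • (β' - β))
      have e : sysComp X (β + t • (β' - β)) γ = sysComp X β γ + t • d := by
        simp only [sysComp, map_add, map_smul, hd]; abel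
      rw [e] at h1
      have h2 := hl.le_add_inner_add (sysComp X β γ) (t • d)
      rw [inner_smul_right, norm_smul, mul_pow, Real.norm_eq_abs, sq_abs] at h2
      have h3 := mul_le_mul_of_nonneg_left (l1norm_convex β β' ht.le ht1) hκ
      linarith
  linarith

/-- The quadratic optimality condition in `γ`. -/
theorem quad_nonneg_of_gamma_optimal (hl : OneSmooth l) {q : ℕ}
    {β : EuclideanSpace ℝ (Fin p)} {γ : EuclideanSpace ℝ (Fin n)}
    (h : ∀ γ' : EuclideanSpace ℝ (Fin n), l0norm γ' ≤ q → l (sysComp X β γ) ≤ l (sysComp X β γ'))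
    (d : EuclideanSpace ℝ (Fin n)) (hd : l0norm (γ + d) ≤ q) :
    0 ≤ inner ℝ (gradient l (sysComp X β γ)) d + ‖d‖ ^ 2 / 2 := by
  have h1 := h (γ + d) hd
  have e : sysComp X β (γ + d) = sysComp X β γ + d := by simp only [sysComp]; abel
  rw [e] at h1
  linarith [hl.le_add_inner_add (sysComp X β γ) d]

/-- Quantile thresholding: if `γ` satisfies the quadratic optimality condition with sparsity
level `q`, then the first order condition holds in every direction towards an `o`-sparse vector
up to a term that decreases with `q / o`. -/
theorem inner_le_of_quantile_threshold {q o : ℕ} {θ : ℝ} (hθ : 1 ≤ θ) (hq : (q : ℝ) = θ * o)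
    {g γ γ' : EuclideanSpace ℝ (Fin n)} (hγ : l0norm γ ≤ q) (hγ' : l0norm γ' ≤ o)
    (hopt : ∀ d : EuclideanSpace ℝ (Fin n), l0norm (γ + d) ≤ q → 0 ≤ inner ℝ g d + ‖d‖ ^ 2 / 2) :
    inner ℝ g (γ - γ') ≤ ‖γ - γ'‖ ^ 2 / (2 * √θ) := by
  classical
  rw [l0norm_eq_card_supp] at hγ hγ'
  -- `supp γ` may have fewer than `q` elements; enlarging it to the full budget, capped at `n`,
  -- makes the later count exact.
  obtain ⟨H, hH, hHcard⟩ : ∃ H : Finset (Fin n), supp γ ⊆ H ∧ H.card = min q n := by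
    obtain ⟨H, h1, -, h2⟩ := Finset.exists_subsuperset_card_eq (Finset.subset_univ (supp γ))
      (le_min hγ (by simpa using Finset.card_le_univ (supp γ))) (by simp : min q n ≤ _)
    exact ⟨H, h1, h2⟩
  have hHq : H.card ≤ q := hHcard ▸ min_le_left _ _
  have hγ0 : ∀ i, i ∉ H → γ i = 0 := fun i hi => by
    by_contra h
    exact hi (hH (mem_supp.2 h))
  -- Moving coordinate `i` by `-g i` stays feasible and changes the quadratic bound by `-g i ^ 2 /
  -- 2`.
  have hg0 : ∀ i ∈ H, g i = 0 := by
    intro i hi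
    have h := hopt (EuclideanSpace.single i (-g i)) ((l0norm_le_card (s := H) fun k hk => by
      by_contra hkH
      have : k ≠ i := fun e => hkH (e ▸ hi)
      exact hk (by simp [hγ0 k hkH, this])).trans hHq)
    simp [EuclideanSpace.inner_single_right] at h
    nlinarith [sq_nonneg (g i)]
  -- Exchange argument: `j` leaves the support and `i` enters it with value `-g i`.
  have hgle : ∀ i, i ∉ H → ∀ j ∈ H, g i ^ 2 ≤ γ j ^ 2 := by
    intro i hi j hj
    have hij : i ≠ j := fun e => hi (e ▸ hj)
    have h := hopt (EuclideanSpace.single i (-g i) + EuclideanSpace.single j (-γ j))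
      ((l0norm_le_card (s := insert i (H.erase j)) fun k hk => by
        by_contra hkH
        simp only [Finset.mem_insert, Finset.mem_erase, not_or, not_and'] at hkH
        obtain ⟨hki, hkj⟩ := hkH
        rcases eq_or_ne k j with rfl | hne
        · exact hk (by simp [hki])
        · exact hk (by simp [hγ0 k (fun hk => hkj hk hne), hne, hki])).trans
        ((Finset.card_insert_le _ _).trans (by
          rw [Finset.card_erase_of_mem hj]
          have := Finset.card_pos.2 ⟨j, hj⟩
          omega)))
    have hnorm : ‖EuclideanSpace.single i (-g i) + EuclideanSpace.single j (-γ j)‖ ^ 2 =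
        g i ^ 2 + γ j ^ 2 := by
      rw [norm_add_sq_real]
      simp [EuclideanSpace.inner_single_right, hij]
    rw [hnorm, inner_add_right] at h
    simp [EuclideanSpace.inner_single_right, hg0 j hj] at h
    nlinarith
  set S := supp γ' \ H with hS
  set B := H \ supp γ' with hB
  have hsum : inner ℝ g (γ - γ') = -∑ i ∈ S, g i * γ' i := by
    rw [PiLp.inner_apply, ← Finset.sum_neg_distrib, ← Finset.sum_subset (Finset.subset_univ S)]
    · refine Finset.sum_congr rfl fun i hi => ?_
      have := hγ0 i (Finset.mem_sdiff.1 hi).2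
      simp [this]
      ring
    · intro i _ hi
      by_cases hiH : i ∈ H
      · simp [hg0 i hiH]
      · have : γ' i = 0 := by
          by_contra h0
          exact hi (Finset.mem_sdiff.2 ⟨mem_supp.2 h0, hiH⟩)
        simp [this, hγ0 i hiH]
  have hnorm : ∑ i ∈ S, γ' i ^ 2 + ∑ j ∈ B, γ j ^ 2 ≤ ‖γ - γ'‖ ^ 2 := by
    rw [EuclideanSpace.real_norm_sq_eq]
    have hdisj : Disjoint S B := by
      rw [Finset.disjoint_left]
      exact fun i hi hi' => (Finset.mem_sdiff.1 hi).2 (Finset.mem_sdiff.1 hi').1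
    have e1 : ∑ i ∈ S, γ' i ^ 2 = ∑ i ∈ S, (γ - γ') i ^ 2 := Finset.sum_congr rfl fun i hi => by
      simp [hγ0 i (Finset.mem_sdiff.1 hi).2]
    have e2 : ∑ i ∈ B, γ i ^ 2 = ∑ i ∈ B, (γ - γ') i ^ 2 := Finset.sum_congr rfl fun i hi => by
      have : γ' i = 0 := by
        by_contra h0
        exact (Finset.mem_sdiff.1 hi).2 (mem_supp.2 h0)
      simp [this]
    rw [e1, e2, ← Finset.sum_union hdisj]
    exact Finset.sum_le_sum_of_subset_of_nonneg (Finset.subset_univ _) fun i _ _ => sq_nonneg _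
  -- Averaging the pairwise exchange bounds over `S × B` gains the factor `|B| / |S|`, which is at
  -- least `θ`.
  have hg : θ * ∑ i ∈ S, g i ^ 2 ≤ ∑ j ∈ B, γ j ^ 2 := by
    rcases S.eq_empty_or_nonempty with hemp | hne
    · rw [hemp]
      simpa using Finset.sum_nonneg fun j _ => sq_nonneg (γ j)
    have hm : (0 : ℝ) < S.card := by exact_mod_cast Finset.card_pos.2 hne
    have hHeq : H.card = q := by
      rcases le_total q n with h | h
      · rw [hHcard, min_eq_left h]
      · exfalso
        have : H = Finset.univ := by
          rw [← Finset.card_eq_iff_eq_univ, hHcard, min_eq_right h, Fintype.card_fin]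
        rw [hS, this, Finset.sdiff_eq_empty_iff_subset.2 (Finset.subset_univ _)] at hne
        exact Finset.not_nonempty_empty hne
    -- With `c` common indices, `|S| + c ≤ o` and `|B| + c = θ o`, so `|B| ≥ θ |S| + (θ - 1) c`.
    have hcard : (S.card : ℝ) * θ ≤ B.card := by
      have c1 := Finset.card_sdiff_add_card_inter (supp γ') H
      have c2 := Finset.card_sdiff_add_card_inter H (supp γ')
      rw [Finset.inter_comm] at c2
      have c3 : (S.card : ℝ) + ((supp γ' ∩ H).card : ℝ) ≤ o := by
        rw [← Nat.cast_add, c1]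
        exact_mod_cast hγ'
      have c4 : (B.card : ℝ) + ((supp γ' ∩ H).card : ℝ) = θ * o := by
        rw [← hq, ← hHeq, ← c2, Nat.cast_add]
      have c5 : (0 : ℝ) ≤ ((supp γ' ∩ H).card : ℝ) := Nat.cast_nonneg _
      nlinarith
    have hdouble : (B.card : ℝ) * ∑ i ∈ S, g i ^ 2 ≤ S.card * ∑ j ∈ B, γ j ^ 2 := by
      calc (B.card : ℝ) * ∑ i ∈ S, g i ^ 2 = ∑ i ∈ S, ∑ j ∈ B, g i ^ 2 := by
            simp [Finset.mul_sum]
        _ ≤ ∑ i ∈ S, ∑ j ∈ B, γ j ^ 2 := Finset.sum_le_sum fun i hi => Finset.sum_le_sum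
            fun j hj => hgle i (Finset.mem_sdiff.1 hi).2 j (Finset.mem_sdiff.1 hj).1
        _ = _ := by simp
    have hgs : 0 ≤ ∑ i ∈ S, g i ^ 2 := Finset.sum_nonneg fun i _ => sq_nonneg _
    refine le_of_mul_le_mul_left ?_ hm
    nlinarith
  have hθs : 0 < √θ := Real.sqrt_pos.2 (by linarith)
  rw [hsum, le_div_iff₀ (by positivity)]
  -- Completing the square with weight `√θ` balances the two sums and yields the rate `1 / √θ`.
  have hterm : -(∑ i ∈ S, g i * γ' i) * (2 * √θ) ≤ θ * ∑ i ∈ S, g i ^ 2 + ∑ i ∈ S, γ' i ^ 2 := by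
    rw [← Finset.sum_neg_distrib, Finset.sum_mul, Finset.mul_sum, ← Finset.sum_add_distrib]
    refine Finset.sum_le_sum fun i _ => ?_
    have hsq : √θ ^ 2 = θ := Real.sq_sqrt (by linarith)
    have := sq_nonneg (√θ * g i + γ' i)
    rw [add_sq, mul_pow, hsq] at this
    linarith
  linarith

end Deterministic

/-! ### Splitting the noise along a data-dependent model space. -/

section Noise

variable {n p : ℕ}

open Classical in
/-- The span of the columns of `X` with index in `S` and of the coordinate vectors with index
in `T`. -/
noncomputable def modelSpace (X : Matrix (Fin n) (Fin p) ℝ) (S : Finset (Fin p)) (T : Finset (Fin n)) :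
    Submodule ℝ (EuclideanSpace ℝ (Fin n)) :=
  Submodule.span ℝ (((S.image fun j => Matrix.toEuclideanLin X (EuclideanSpace.single j 1)) ∪
    T.image fun i => EuclideanSpace.single i (1 : ℝ) : Finset (EuclideanSpace ℝ (Fin n))) :
      Set (EuclideanSpace ℝ (Fin n)))

theorem finrank_modelSpace_le (X : Matrix (Fin n) (Fin p) ℝ) (S : Finset (Fin p))
    (T : Finset (Fin n)) : Module.finrank ℝ (modelSpace X S T) ≤ S.card + T.card := by
  classical
  unfold modelSpace
  refine (finrank_span_finset_le_card _).trans ((Finset.card_union_le _ _).trans ?_)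
  exact add_le_add Finset.card_image_le Finset.card_image_le

theorem column_mem_modelSpace (X : Matrix (Fin n) (Fin p) ℝ) {S : Finset (Fin p)}
    (T : Finset (Fin n)) {j : Fin p} (hj : j ∈ S) :
    Matrix.toEuclideanLin X (EuclideanSpace.single j 1) ∈ modelSpace X S T := by
  classical
  refine Submodule.subset_span ?_
  simp only [Finset.coe_union, Finset.coe_image]
  exact Or.inl ⟨j, hj, rfl⟩

theorem single_mem_modelSpace (X : Matrix (Fin n) (Fin p) ℝ) (S : Finset (Fin p))
    {T : Finset (Fin n)} {i : Fin n} (hi : i ∈ T) :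
    EuclideanSpace.single i 1 ∈ modelSpace X S T := by
  classical
  refine Submodule.subset_span ?_
  simp only [Finset.coe_union, Finset.coe_image]
  exact Or.inr ⟨i, hi, rfl⟩

theorem modelSpace_mono (X : Matrix (Fin n) (Fin p) ℝ) {S S' : Finset (Fin p)} (h : S ⊆ S')
    (T : Finset (Fin n)) : modelSpace X S T ≤ modelSpace X S' T := by
  classical
  refine Submodule.span_mono ?_
  exact_mod_cast Finset.union_subset_union_left (Finset.image_subset_image h)

theorem euclidean_eq_sum_single {m : ℕ} (v : EuclideanSpace ℝ (Fin m)) :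
    v = ∑ i, v i • EuclideanSpace.single i (1 : ℝ) := by
  ext k
  simp [Finset.sum_apply, Pi.single_apply]

theorem norm_column_le {X : Matrix (Fin n) (Fin p) ℝ} {ρ : ℝ} (hX : spectralNorm X ≤ ρ)
    (j : Fin p) : ‖Matrix.toEuclideanLin X (EuclideanSpace.single j 1)‖ ≤ ρ := by
  have h := (Matrix.toEuclideanLin X).toContinuousLinearMap.le_opNorm (EuclideanSpace.single j 1)
  rw [PiLp.norm_single, norm_one, mul_one] at h
  exact h.trans hX

/-- Adding a direction to a subspace increases the squared norm of the projection. -/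
theorem norm_starProjection_sq_add_le {V V' : Submodule ℝ (EuclideanSpace ℝ (Fin n))} (hV : V ≤ V')
    {x : EuclideanSpace ℝ (Fin n)} (hx : x ∈ V') (e : EuclideanSpace ℝ (Fin n)) {ρ : ℝ}
    (hρ : 0 < ρ) (hxρ : ‖x‖ ≤ ρ) :
    ‖V.starProjection e‖ ^ 2 + (inner ℝ (e - V.starProjection e) x / ρ) ^ 2 ≤
      ‖V'.starProjection e‖ ^ 2 := by
  set r := e - V.starProjection e with hr
  set a := inner ℝ r x with ha
  have hpyth : ∀ U : Submodule ℝ (EuclideanSpace ℝ (Fin n)),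
      ‖e‖ ^ 2 = ‖U.starProjection e‖ ^ 2 + ‖e - U.starProjection e‖ ^ 2 := fun U => by
    have h := U.norm_sq_eq_add_norm_sq_starProjection e
    rwa [Submodule.starProjection_orthogonal_val] at h
  -- The competitor uses the step `a / ρ²` rather than the optimal `a / ‖x‖²`; this covers `x = 0`,
  -- and `‖x‖ ≤ ρ` keeps the gain `(a / ρ)²`.
  have hmin : ‖e - V'.starProjection e‖ ≤ ‖e - (V.starProjection e + (a / ρ ^ 2) • x)‖ := by
    rw [Submodule.starProjection_minimal]
    refine ciInf_le (f := fun w : V' => ‖e - w‖) ⟨0, ?_⟩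
      ⟨_, V'.add_mem (hV (V.starProjection_apply_mem e)) (V'.smul_mem (a / ρ ^ 2) hx)⟩
    rintro _ ⟨w, rfl⟩
    exact norm_nonneg _
  have hexp : ‖e - (V.starProjection e + (a / ρ ^ 2) • x)‖ ^ 2 =
      ‖r‖ ^ 2 - 2 * (a / ρ ^ 2) * a + (a / ρ ^ 2) ^ 2 * ‖x‖ ^ 2 := by
    rw [← sub_sub, ← hr, norm_sub_sq_real, inner_smul_right, norm_smul, mul_pow,
      Real.norm_eq_abs, sq_abs, ← ha]
    ring
  have h1 : ‖e - V'.starProjection e‖ ^ 2 ≤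
      ‖r‖ ^ 2 - 2 * (a / ρ ^ 2) * a + (a / ρ ^ 2) ^ 2 * ‖x‖ ^ 2 := by
    rw [← hexp]; gcongr
  have h2 : (a / ρ ^ 2) ^ 2 * ‖x‖ ^ 2 ≤ (a / ρ ^ 2) ^ 2 * ρ ^ 2 := by gcongr
  have h3 : - (2 * (a / ρ ^ 2) * a) + (a / ρ ^ 2) ^ 2 * ρ ^ 2 = -(a / ρ) ^ 2 := by
    field_simp; ring
  linarith [hpyth V, hpyth V']

/-- The noise splits into a part in a model space of low dimension and a part that is almost
orthogonal to all columns of `X`. -/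
theorem exists_modelSpace_inner_le {X : Matrix (Fin n) (Fin p) ℝ} {ρ κ : ℝ} (hρ : 0 < ρ)
    (hX : spectralNorm X ≤ ρ) (hκ : 0 ≤ κ) (T : Finset (Fin n)) (e : EuclideanSpace ℝ (Fin n)) :
    ∃ S : Finset (Fin p),
      κ ^ 2 * S.card ≤ ‖(modelSpace X S T).starProjection e‖ ^ 2 ∧
      ∀ (β : EuclideanSpace ℝ (Fin p)) (γ : EuclideanSpace ℝ (Fin n)), supp γ ⊆ T →
        inner ℝ e (sysComp X β γ) ≤
          ‖(modelSpace X S T).starProjection e‖ * ‖sysComp X β γ‖ + κ * ρ * l1norm β := by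
  classical
  -- Maximality is used twice: against `∅` it bounds `S.card`, and against `insert j S` it bounds
  -- the correlation of the residual with column `j`.
  obtain ⟨S, -, hS⟩ := Finset.exists_max_image (Finset.univ : Finset (Finset (Fin p)))
    (fun S => ‖(modelSpace X S T).starProjection e‖ ^ 2 - κ ^ 2 * S.card) ⟨∅, Finset.mem_univ _⟩
  refine ⟨S, ?_, fun β γ hγ => ?_⟩
  · have := hS ∅ (Finset.mem_univ _)
    simp only [Finset.card_empty, Nat.cast_zero, mul_zero, sub_zero] at this
    nlinarith [sq_nonneg ‖(modelSpace X ∅ T).starProjection e‖]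
  set V := modelSpace X S T with hV
  set r := e - V.starProjection e with hr
  have hcol : ∀ j, |inner ℝ r (Matrix.toEuclideanLin X (EuclideanSpace.single j 1))| ≤ κ * ρ := by
    intro j
    have h1 := norm_starProjection_sq_add_le (modelSpace_mono X (Finset.subset_insert j S) T)
      (column_mem_modelSpace X T (Finset.mem_insert_self j S)) e hρ (norm_column_le hX j)
    have h2 := hS (insert j S) (Finset.mem_univ _)
    have h3 : ((insert j S).card : ℝ) ≤ S.card + 1 := by exact_mod_cast Finset.card_insert_le j S
    have h4 := mul_le_mul_of_nonneg_left h3 (sq_nonneg κ)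
    have h5 : (inner ℝ r (Matrix.toEuclideanLin X (EuclideanSpace.single j 1)) / ρ) ^ 2 ≤ κ ^ 2 := by
      rw [hr, hV]
      linarith
    have h6 := abs_le_of_sq_le_sq h5 hκ
    rw [abs_div, abs_of_pos hρ, div_le_iff₀ hρ] at h6
    exact h6
  have hrγ : inner ℝ r γ = 0 := by
    rw [euclidean_eq_sum_single γ, inner_sum]
    refine Finset.sum_eq_zero fun i _ => ?_
    rw [inner_smul_right]
    by_cases hi : i ∈ supp γ
    · rw [V.starProjection_inner_eq_zero e _ (single_mem_modelSpace X S (hγ hi)), mul_zero]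
    · rw [mem_supp, not_not] at hi
      rw [hi, zero_mul]
  have hrβ : inner ℝ r (Matrix.toEuclideanLin X β) ≤ κ * ρ * l1norm β := by
    conv_lhs => rw [euclidean_eq_sum_single β]
    rw [map_sum, inner_sum, l1norm, Finset.mul_sum]
    refine Finset.sum_le_sum fun j _ => ?_
    rw [map_smul, inner_smul_right]
    refine (le_abs_self _).trans ?_
    rw [abs_mul, mul_comm]
    exact mul_le_mul_of_nonneg_right (hcol j) (abs_nonneg _)
  have hsplit : inner ℝ e (sysComp X β γ) =
      inner ℝ (V.starProjection e) (sysComp X β γ) + inner ℝ r (sysComp X β γ) := by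
    rw [← inner_add_left, hr, add_sub_cancel]
  rw [hsplit]
  refine add_le_add (real_inner_le_norm _ _) ?_
  rw [sysComp, inner_add_right, hrγ, add_zero]
  exact hrβ

end Noise

/-! ### Control of the noise over all model spaces in expectation. -/

section Union

variable {n p : ℕ} {Ω : Type*} [MeasurableSpace Ω] {μ : Measure Ω}

/-- The sum over all model spaces of the exponentials of the standardized and penalized squared
norms of the projected noise. -/
noncomputable def noiseExcess (X : Matrix (Fin n) (Fin p) ℝ) (σ L R : ℝ) (m : ℕ)
    (e : EuclideanSpace ℝ (Fin n)) : ℝ :=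
  ∑ S : Finset (Fin p), ∑ T : Finset (Fin n) with T.card ≤ m,
    Real.exp (‖(modelSpace X S T).starProjection e‖ ^ 2 / (32 * σ ^ 2) - (2 * S.card * L + R))

/-- A positive sum dominates each of its terms, and `x + 1 ≤ exp x` returns from the exponential to
the exponent. The bound is uniform in `S` and `T`, so it applies to random choices. -/
theorem norm_starProjection_sq_le_noiseExcess (X : Matrix (Fin n) (Fin p) ℝ) {σ : ℝ} (hσ : 0 < σ)
    (L R : ℝ) {m : ℕ} (e : EuclideanSpace ℝ (Fin n)) (S : Finset (Fin p)) {T : Finset (Fin n)}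
    (hT : T.card ≤ m) :
    ‖(modelSpace X S T).starProjection e‖ ^ 2 ≤
      32 * σ ^ 2 * (2 * S.card * L + R + noiseExcess X σ L R m e) := by
  set a := ‖(modelSpace X S T).starProjection e‖ ^ 2 / (32 * σ ^ 2) with ha
  have h1 : Real.exp (a - (2 * S.card * L + R)) ≤ noiseExcess X σ L R m e := by
    unfold noiseExcess
    refine le_trans ?_ (Finset.single_le_sum (f := fun S : Finset (Fin p) =>
      ∑ T : Finset (Fin n) with T.card ≤ m,
        Real.exp (‖(modelSpace X S T).starProjection e‖ ^ 2 / (32 * σ ^ 2) - (2 * S.card * L + R)))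
      (fun S _ => Finset.sum_nonneg fun T _ => (Real.exp_pos _).le) (Finset.mem_univ S))
    exact Finset.single_le_sum (f := fun T : Finset (Fin n) =>
        Real.exp (‖(modelSpace X S T).starProjection e‖ ^ 2 / (32 * σ ^ 2) - (2 * S.card * L + R)))
      (fun T _ => (Real.exp_pos _).le) (Finset.mem_filter.2 ⟨Finset.mem_univ T, hT⟩)
  have h2 := Real.add_one_le_exp (a - (2 * S.card * L + R))
  have h3 : ‖(modelSpace X S T).starProjection e‖ ^ 2 = 32 * σ ^ 2 * a := by
    rw [ha]; field_simp
  rw [h3]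
  gcongr
  linarith

theorem noiseExcess_nonneg (X : Matrix (Fin n) (Fin p) ℝ) (σ L R : ℝ) (m : ℕ)
    (e : EuclideanSpace ℝ (Fin n)) : 0 ≤ noiseExcess X σ L R m e :=
  Finset.sum_nonneg fun _ _ => Finset.sum_nonneg fun _ _ => (Real.exp_pos _).le

theorem sum_pow_card (m : ℕ) {a : ℝ} :
    ∑ S : Finset (Fin m), a ^ S.card = (1 + a) ^ m := by
  have h := Finset.prod_one_add (f := fun _ : Fin m => a) Finset.univ
  simp only [Finset.prod_const, Finset.card_univ, Fintype.card_fin, Finset.powerset_univ] at h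
  exact h.symm

theorem one_add_pow_le_exp (m : ℕ) {a : ℝ} (ha : 0 ≤ a) : (1 + a) ^ m ≤ Real.exp (m * a) := by
  rw [Real.exp_nat_mul]
  gcongr
  linarith [Real.add_one_le_exp a]

/-- The number of subsets of size at most `m`, in exponential form. -/
theorem sum_exp_card_le {o m : ℕ} (hon : o ≤ n) (hom : o ≤ m) (hm0 : o = 0 → m = 0) :
    ∑ T : Finset (Fin n) with T.card ≤ m, Real.exp T.card ≤
      Real.exp (2 * m * Real.log (Real.exp 1 * n / o)) := by
  -- Division by zero makes the logarithm `Real.log 0 = 0`, so the right side is 1; the hypothesis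
  -- forces `m = 0`, and only the empty set is counted.
  rcases Nat.eq_zero_or_pos o with h0 | h0
  · have hm := hm0 h0
    subst hm
    have : (Finset.univ.filter fun T : Finset (Fin n) => T.card ≤ 0) = {∅} := by
      ext T; simp
    rw [this]
    simp
  have ho : (0 : ℝ) < o := by exact_mod_cast h0
  have hn : (0 : ℝ) < n := lt_of_lt_of_le ho (by exact_mod_cast hon)
  have hr : (1 : ℝ) ≤ n / o := by rw [one_le_div ho]; exact_mod_cast hon
  have hr0 : (0 : ℝ) < n / o := by positivity
  have hexp : Real.exp (2 * m * Real.log (Real.exp 1 * n / o)) =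
      Real.exp m * Real.exp m * ((n / o : ℝ) ^ m * (n / o : ℝ) ^ m) := by
    rw [mul_div_assoc, Real.log_mul (Real.exp_pos 1).ne' hr0.ne', Real.log_exp,
      ← Real.exp_log (pow_pos hr0 m), Real.log_pow, ← Real.exp_add, ← Real.exp_add,
      ← Real.exp_add]
    ring_nf
  -- The weight `(n/o)^m (o/n)^|T|` is at least 1 when `|T| ≤ m`; with it the sum may run over all
  -- subsets and becomes a binomial.
  have hterm : ∀ T ∈ Finset.univ.filter (fun T : Finset (Fin n) => T.card ≤ m),
      Real.exp T.card ≤ Real.exp m * ((n / o : ℝ) ^ m * (o / n : ℝ) ^ T.card) := by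
    intro T hT
    have hT := (Finset.mem_filter.1 hT).2
    have h1 : (1 : ℝ) ≤ (n / o : ℝ) ^ m * (o / n : ℝ) ^ T.card := by
      rw [← inv_div (n : ℝ) o, inv_pow, ← div_eq_mul_inv, one_le_div (pow_pos hr0 _)]
      exact pow_le_pow_right₀ hr hT
    calc Real.exp T.card ≤ Real.exp m * 1 := by
          rw [mul_one]; exact Real.exp_le_exp.2 (by exact_mod_cast hT)
      _ ≤ _ := by gcongr
  calc ∑ T : Finset (Fin n) with T.card ≤ m, Real.exp T.card
      ≤ ∑ T : Finset (Fin n) with T.card ≤ m,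
          Real.exp m * ((n / o : ℝ) ^ m * (o / n : ℝ) ^ T.card) := Finset.sum_le_sum hterm
    _ ≤ ∑ T : Finset (Fin n), Real.exp m * ((n / o : ℝ) ^ m * (o / n : ℝ) ^ T.card) :=
        Finset.sum_le_sum_of_subset_of_nonneg (Finset.filter_subset _ _)
          fun T _ _ => by positivity
    _ = Real.exp m * ((n / o : ℝ) ^ m * (1 + (o / n : ℝ)) ^ n) := by
        rw [← Finset.mul_sum, ← Finset.mul_sum, sum_pow_card]
    _ ≤ Real.exp m * ((n / o : ℝ) ^ m * Real.exp m) := by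
        have h1 := one_add_pow_le_exp n (a := (o / n : ℝ)) (by positivity)
        rw [mul_div_cancel₀ _ hn.ne'] at h1
        have h2 : Real.exp o ≤ Real.exp m := Real.exp_le_exp.2 (by exact_mod_cast hom)
        gcongr
        exact h1.trans h2
    _ = Real.exp m * Real.exp m * ((n / o : ℝ) ^ m * 1) := by ring
    _ ≤ _ := by
        rw [hexp]
        gcongr
        exact one_le_pow₀ hr

/-- The penalty `2 |S| log (e p)` pays for the dimension `|S|` and for the number of subsets,
leaving at most `p⁻¹` per chosen column. -/
theorem sum_exp_card_sub_le (hp : 0 < p) :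
    ∑ S : Finset (Fin p), Real.exp (S.card - 2 * S.card * Real.log (Real.exp 1 * p)) ≤ 3 := by
  have hp' : (1 : ℝ) ≤ p := by exact_mod_cast hp
  have hL : Real.log (Real.exp 1 * p) = 1 + Real.log p := by
    rw [Real.log_mul (Real.exp_pos 1).ne' (by linarith), Real.log_exp]
  have hlog : 0 ≤ Real.log p := Real.log_nonneg hp'
  calc ∑ S : Finset (Fin p), Real.exp (S.card - 2 * S.card * Real.log (Real.exp 1 * p))
      ≤ ∑ S : Finset (Fin p), ((p : ℝ)⁻¹) ^ S.card := by
        refine Finset.sum_le_sum fun S _ => ?_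
        rw [← Real.exp_log (inv_pos.2 (lt_of_lt_of_le one_pos hp')), ← Real.exp_nat_mul, hL,
          Real.log_inv]
        refine Real.exp_le_exp.2 ?_
        have : (0 : ℝ) ≤ S.card := Nat.cast_nonneg _
        nlinarith [mul_nonneg this hlog]
    _ = (1 + (p : ℝ)⁻¹) ^ p := sum_pow_card p
    _ ≤ Real.exp (p * (p : ℝ)⁻¹) := one_add_pow_le_exp p (by positivity)
    _ = Real.exp 1 := by rw [mul_inv_cancel₀ (by linarith)]
    _ ≤ 3 := Real.exp_one_lt_three.le

theorem aemeasurable_noiseExcess {e : Ω → EuclideanSpace ℝ (Fin n)} {σ : ℝ}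
    (he : IsSubGaussianVec e σ μ) (X : Matrix (Fin n) (Fin p) ℝ) (L R : ℝ) (m : ℕ) :
    AEMeasurable (fun ω => noiseExcess X σ L R m (e ω)) μ := by
  unfold noiseExcess
  refine Finset.aemeasurable_fun_sum _ fun S _ => Finset.aemeasurable_fun_sum _ fun T _ => ?_
  exact Real.measurable_exp.comp_aemeasurable
    (((aemeasurable_norm_starProjection_sq he _).div_const _).sub_const _)

/-- Since `modelSpace X S T` has dimension at most `|S| + |T|`, the moment bound factors into a sum
over `S` and a sum over `T`, each offset by its own penalty. -/
theorem lintegral_noiseExcess_le [IsProbabilityMeasure μ] {e : Ω → EuclideanSpace ℝ (Fin n)} {σ : ℝ}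
    (hσ : 0 < σ) (he : IsSubGaussianVec e σ μ) (X : Matrix (Fin n) (Fin p) ℝ) (hp : 0 < p)
    {o m : ℕ} (hon : o ≤ n) (hom : o ≤ m) (hm0 : o = 0 → m = 0) :
    ∫⁻ ω, ENNReal.ofReal (noiseExcess X σ (Real.log (Real.exp 1 * p))
      (2 * m * Real.log (Real.exp 1 * n / o)) m (e ω)) ∂μ ≤ ENNReal.ofReal 3 := by
  set L := Real.log (Real.exp 1 * p)
  set R := 2 * m * Real.log (Real.exp 1 * n / o)
  have hmeas : ∀ (S : Finset (Fin p)) (T : Finset (Fin n)), AEMeasurable (fun ω =>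
      Real.exp (‖(modelSpace X S T).starProjection (e ω)‖ ^ 2 / (32 * σ ^ 2) -
        (2 * S.card * L + R))) μ := fun S T =>
    Real.measurable_exp.comp_aemeasurable
      (((aemeasurable_norm_starProjection_sq he _).div_const _).sub_const _)
  have hterm : ∀ (S : Finset (Fin p)) (T : Finset (Fin n)), ∫⁻ ω, ENNReal.ofReal
      (Real.exp (‖(modelSpace X S T).starProjection (e ω)‖ ^ 2 / (32 * σ ^ 2) -
        (2 * S.card * L + R))) ∂μ ≤
      ENNReal.ofReal (Real.exp (S.card - 2 * S.card * L) * (Real.exp T.card * Real.exp (-R))) := by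
    intro S T
    have h := lintegral_exp_norm_starProjection_sq_le hσ he (modelSpace X S T)
    simp only [Real.exp_sub, div_eq_mul_inv _ (Real.exp (2 * S.card * L + R)),
      ENNReal.ofReal_mul (Real.exp_pos _).le]
    rw [lintegral_mul_const' _ _ ENNReal.ofReal_ne_top]
    refine (mul_le_mul_left (h.trans (ENNReal.ofReal_le_ofReal (Real.exp_le_exp.2
      (Nat.cast_le.2 (finrank_modelSpace_le X S T))))) _).trans (le_of_eq ?_)
    rw [← ENNReal.ofReal_mul (Real.exp_pos _).le]
    congr 1
    simp only [← Real.exp_neg, div_eq_mul_inv, ← Real.exp_add]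
    push_cast
    ring_nf
  have hsum : ∀ ω, ENNReal.ofReal (noiseExcess X σ L R m (e ω)) =
      ∑ S : Finset (Fin p), ∑ T : Finset (Fin n) with T.card ≤ m, ENNReal.ofReal
        (Real.exp (‖(modelSpace X S T).starProjection (e ω)‖ ^ 2 / (32 * σ ^ 2) -
          (2 * S.card * L + R))) := by
    intro ω
    rw [noiseExcess, ENNReal.ofReal_sum_of_nonneg
      fun S _ => Finset.sum_nonneg fun T _ => (Real.exp_pos _).le]
    exact Finset.sum_congr rfl fun S _ => ENNReal.ofReal_sum_of_nonneg
      fun T _ => (Real.exp_pos _).le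
  simp only [hsum]
  rw [lintegral_finsetSum' _ fun S _ => Finset.aemeasurable_fun_sum _
    fun T _ => (hmeas S T).ennreal_ofReal]
  calc _ ≤ ∑ S : Finset (Fin p), ∑ T : Finset (Fin n) with T.card ≤ m, ENNReal.ofReal
        (Real.exp (S.card - 2 * S.card * L) * (Real.exp T.card * Real.exp (-R))) := by
        refine Finset.sum_le_sum fun S _ => ?_
        rw [lintegral_finsetSum' _ fun T _ => (hmeas S T).ennreal_ofReal]
        exact Finset.sum_le_sum fun T _ => hterm S T
    _ = ENNReal.ofReal ((∑ S : Finset (Fin p), Real.exp (S.card - 2 * S.card * L)) *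
          ((∑ T : Finset (Fin n) with T.card ≤ m, Real.exp T.card) * Real.exp (-R))) := by
        rw [Finset.sum_mul, ENNReal.ofReal_sum_of_nonneg fun S _ => by positivity]
        refine Finset.sum_congr rfl fun S _ => ?_
        rw [Finset.sum_mul, Finset.mul_sum, ENNReal.ofReal_sum_of_nonneg fun S _ => by positivity]
    _ ≤ ENNReal.ofReal 3 := by
        refine ENNReal.ofReal_le_ofReal ?_
        have h1 := sum_exp_card_sub_le hp
        have h2 : (∑ T : Finset (Fin n) with T.card ≤ m, Real.exp T.card) * Real.exp (-R) ≤ 1 := by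
          rw [Real.exp_neg, ← div_eq_mul_inv, div_le_one (Real.exp_pos _)]
          exact sum_exp_card_le hon hom hm0
        calc _ ≤ 3 * (1 : ℝ) := by gcongr
          _ = 3 := by norm_num

end Union

/-! ### The oracle inequality and the risk bound. -/

section Risk

variable {n p : ℕ}

theorem l1norm_sub_l1norm_le (β β' : EuclideanSpace ℝ (Fin p)) :
    l1norm β' - l1norm β ≤
      ∑ j ∈ supp β', |β j - β' j| - ∑ j ∈ (supp β')ᶜ, |β j - β' j| := by
  classical
  simp only [l1norm]
  rw [← Finset.sum_add_sum_compl (supp β') fun j => |β j|,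
    ← Finset.sum_add_sum_compl (supp β') fun j => |β' j|]
  have h1 : ∑ j ∈ supp β', |β' j| ≤ ∑ j ∈ supp β', |β j| + ∑ j ∈ supp β', |β j - β' j| := by
    rw [← Finset.sum_add_distrib]
    refine Finset.sum_le_sum fun j _ => ?_
    have := abs_sub_abs_le_abs_sub (β' j) (β j)
    rw [abs_sub_comm] at this
    linarith
  have h0 : ∀ j ∈ (supp β')ᶜ, β' j = 0 := fun j hj => by
    rw [Finset.mem_compl, mem_supp, not_not] at hj
    exact hj
  have h2 : ∑ j ∈ (supp β')ᶜ, |β' j| = 0 := Finset.sum_eq_zero fun j hj => by simp [h0 j hj]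
  have h3 : ∑ j ∈ (supp β')ᶜ, |β j - β' j| = ∑ j ∈ (supp β')ᶜ, |β j| :=
    Finset.sum_congr rfl fun j hj => by simp [h0 j hj]
  linarith

/-- Only the leading coefficients survive as `c` tends to infinity. This removes the linear and
constant terms from the regularity condition after rescaling all its arguments. -/
theorem le_of_forall_sq_mul_le {x y B D : ℝ}
    (h : ∀ c : ℝ, 0 < c → c ^ 2 * x ≤ c ^ 2 * y + c * B + D) : x ≤ y := by
  by_contra! hxy
  have hd : 0 < x - y := sub_pos.2 hxy
  set c := (|B| + |D|) / (x - y) + 1 with hc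
  have hq : 0 ≤ (|B| + |D|) / (x - y) := by positivity
  have hc1 : 1 ≤ c := by linarith
  have h1 := h c (by linarith)
  have h2 : c * (x - y) = |B| + |D| + (x - y) := by
    rw [hc]; field_simp
  have h3 : c * B + D ≤ c * (|B| + |D|) := by
    nlinarith [le_abs_self B, le_abs_self D, abs_nonneg D]
  nlinarith

/-- By homogeneity, the regularity condition bounds the outlier part of an estimation error. -/
theorem GeneralCondition.norm_sq_div_le {l : EuclideanSpace ℝ (Fin n) → ℝ} (hl : OneSmooth l)
    {X : Matrix (Fin n) (Fin p) ℝ} {βs : EuclideanSpace ℝ (Fin p)} {o : ℕ}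
    {lam ρ θ ε δ K : ℝ} (hδ : 0 < δ) (h : GeneralCondition l X βs o lam ρ θ ε δ K)
    {β β' : EuclideanSpace ℝ (Fin p)} {γ γ' : EuclideanSpace ℝ (Fin n)}
    (hγ : (l0norm γ : ℝ) ≤ θ * o) (hγ' : l0norm γ' ≤ o) :
    ‖γ - γ'‖ ^ 2 / (2 * √θ) ≤ ‖sysComp X (β - β') (γ - γ')‖ ^ 2 := by
  refine le_of_forall_sq_mul_le
    (B := lam * ρ * ∑ j ∈ (supp βs)ᶜ, |β j - β' j| -
      (1 + ε) * lam * ρ * ∑ j ∈ supp βs, |β j - β' j|)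
    (D := K ^ 2 * lam ^ 2 * (supp βs).card) fun c hc => ?_
  have h1 := h (c • β) (c • β') (c • γ) (c • γ')
    ((Nat.cast_le.2 (l0norm_smul_le c γ)).trans hγ) ((l0norm_smul_le c γ').trans hγ')
  have h2 := (abs_le.1 (hl.abs_two_mul_symBreg_le (sysComp X (c • β) (c • γ))
    (sysComp X (c • β') (c • γ')))).2
  have e1 : ∀ j, |(c • β) j - (c • β') j| = c * |β j - β' j| := fun j => by
    simp only [PiLp.smul_apply, smul_eq_mul]
    rw [← mul_sub, abs_mul, abs_of_pos hc]
  have e2 : ‖c • γ - c • γ'‖ ^ 2 = c ^ 2 * ‖γ - γ'‖ ^ 2 := by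
    rw [← smul_sub, norm_smul, mul_pow, Real.norm_eq_abs, sq_abs]
  have e3 : ‖sysComp X (c • β) (c • γ) - sysComp X (c • β') (c • γ')‖ ^ 2 =
      c ^ 2 * ‖sysComp X (β - β') (γ - γ')‖ ^ 2 := by
    rw [sysComp_smul, sysComp_smul, ← smul_sub, norm_smul, mul_pow, Real.norm_eq_abs, sq_abs,
      sysComp_sub]
  simp only [e1, ← Finset.mul_sum, breg2, e2, e3] at h1 h2
  have h3 : 0 ≤ δ * (c ^ 2 * ‖sysComp X (β - β') (γ - γ')‖ ^ 2 / 2) := by positivity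
  have h4 : c ^ 2 * (‖γ - γ'‖ ^ 2 / (2 * √θ)) = c ^ 2 * ‖γ - γ'‖ ^ 2 / (2 * √θ) := by ring
  rw [h4]
  linarith

/-- The oracle inequality for an A-estimator, given a bound of the stochastic term. -/
theorem norm_sq_le_of_inner_noise_le {l : EuclideanSpace ℝ (Fin n) → ℝ} (hl : OneSmooth l)
    {X : Matrix (Fin n) (Fin p) ℝ} {βs βh : EuclideanSpace ℝ (Fin p)}
    {γs γh : EuclideanSpace ℝ (Fin n)} {lam ρ θ ε δ K b ζ : ℝ} {q : ℕ}
    (hlam : 0 < lam) (hρ : 0 < ρ) (hθ : 1 ≤ θ) (hq : (q : ℝ) = θ * l0norm γs)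
    (hδ : 0 < δ) (hb : 0 < b) (hb4 : b ≤ 1 / 4) (hbδ : b ≤ δ / 16) (hbε : b * (2 + ε) ≤ ε)
    (hcond : GeneralCondition l X βs (l0norm γs) lam ρ θ ε δ K)
    (hest : IsAEstimator l X lam ρ q βh γh)
    (hnoise : inner ℝ (effectiveNoise l X βs γs) (sysComp X (βh - βs) (γh - γs)) ≤
      ζ * ‖sysComp X (βh - βs) (γh - γs)‖ + b * lam * ρ * l1norm (βh - βs)) :
    ‖sysComp X (βh - βs) (γh - γs)‖ ^ 2 ≤
      16 / δ ^ 2 * ζ ^ 2 + 8 / δ * (K ^ 2 * lam ^ 2 * (supp βs).card) := by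
  classical
  obtain ⟨hβ, hγq, hγ⟩ := hest
  have hκ : 0 < lam * ρ := mul_pos hlam hρ
  have hγθ : (l0norm γh : ℝ) ≤ θ * l0norm γs := by rw [← hq]; exact_mod_cast hγq
  set Δ := sysComp X (βh - βs) (γh - γs) with hΔ
  set G := ‖γh - γs‖ ^ 2 / (2 * √θ) with hG
  set J := ∑ j ∈ supp βs, |βh j - βs j| with hJ
  set Jc := ∑ j ∈ (supp βs)ᶜ, |βh j - βs j| with hJc
  set KK := K ^ 2 * lam ^ 2 * (supp βs).card with hKK
  set B := 2 * symBreg l (sysComp X βh γh) (sysComp X βs γs) with hB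
  have hη : sysComp X βh γh - sysComp X βs γs = Δ := sysComp_sub X βh βs γh γs
  have hJ0 : 0 ≤ J := Finset.sum_nonneg fun _ _ => abs_nonneg _
  have hKK0 : 0 ≤ KK := by positivity
  have hl1 : l1norm (βh - βs) = J + Jc := by
    rw [l1norm, ← Finset.sum_add_sum_compl (supp βs)]
    rfl
  have hc := hcond βh βs γh γs hγθ le_rfl
  rw [breg2, hη] at hc
  have hGle : G ≤ ‖Δ‖ ^ 2 := hcond.norm_sq_div_le hl hδ hγθ le_rfl
  have hBge : -‖Δ‖ ^ 2 ≤ B := by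
    have := (abs_le.1 (hl.abs_two_mul_symBreg_le (sysComp X βh γh) (sysComp X βs γs))).1
    rwa [hη] at this
  have hbasic : B ≤ inner ℝ (effectiveNoise l X βs γs) Δ + G + lam * ρ * (J - Jc) := by
    have h1 := inner_gradient_le_of_beta_optimal hl hκ.le hβ βs
    have h2 := inner_le_of_quantile_threshold hθ hq hγq le_rfl
      (quad_nonneg_of_gamma_optimal hl hγ)
    have h3 := mul_le_mul_of_nonneg_left (l1norm_sub_l1norm_le βh βs) hκ.le
    rw [hB, two_mul_symBreg, hη, inner_sub_left, effectiveNoise, inner_neg_left]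
    have h4 : inner ℝ (gradient l (sysComp X βh γh)) Δ =
        inner ℝ (gradient l (sysComp X βh γh)) (Matrix.toEuclideanLin X (βh - βs)) +
          inner ℝ (gradient l (sysComp X βh γh)) (γh - γs) := by
      rw [← inner_add_right]
      rfl
    linarith
  rw [hl1] at hnoise
  -- Weighting the condition by `1 - b` cancels `Jc` exactly against the noise share `b`. What is
  -- left over, `b * G` and `-b * B`, costs at most `2b ‖Δ‖²`.
  have hcb := mul_le_mul_of_nonneg_left hc (by linarith : 0 ≤ 1 - b)
  -- The coefficient equals `ε - b (2 + ε)`; the slack `ε` of the condition absorbs the noise share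
  -- on the support.
  have hJb : 0 ≤ ((1 - b) * (1 + ε) - (1 + b)) * (lam * ρ * J) :=
    mul_nonneg (by linarith) (mul_nonneg hκ.le hJ0)
  have hGb := mul_le_mul_of_nonneg_left hGle hb.le
  have hBb := mul_le_mul_of_nonneg_left hBge hb.le
  have hδb : δ / 4 * ‖Δ‖ ^ 2 ≤ ((1 - b) * (δ / 2) - 2 * b) * ‖Δ‖ ^ 2 := by
    refine mul_le_mul_of_nonneg_right ?_ (sq_nonneg _)
    nlinarith
  have hbKK : 0 ≤ b * KK := mul_nonneg hb.le hKK0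
  have hmain : δ / 4 * ‖Δ‖ ^ 2 ≤ ζ * ‖Δ‖ + KK := by
    linear_combination hδb + hbasic + hnoise + hcb + hJb + hGb + hBb + hbKK
  have hsq : ζ * ‖Δ‖ ≤ δ / 8 * ‖Δ‖ ^ 2 + 2 / δ * ζ ^ 2 := by
    have h : 0 ≤ 1 / (8 * δ) * (δ * ‖Δ‖ - 4 * ζ) ^ 2 := by positivity
    have e : 1 / (8 * δ) * (δ * ‖Δ‖ - 4 * ζ) ^ 2 =
        δ / 8 * ‖Δ‖ ^ 2 + 2 / δ * ζ ^ 2 - ζ * ‖Δ‖ := by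
      field_simp; ring
    linarith
  have h8 : δ / 8 * ‖Δ‖ ^ 2 ≤ 2 / δ * ζ ^ 2 + KK := by linarith
  calc ‖Δ‖ ^ 2 = 8 / δ * (δ / 8 * ‖Δ‖ ^ 2) := by field_simp
    _ ≤ 8 / δ * (2 / δ * ζ ^ 2 + KK) := by gcongr
    _ = _ := by field_simp; ring

theorem log_exp_one_mul_div_nonneg {o : ℕ} (hon : o ≤ n) :
    0 ≤ Real.log (Real.exp 1 * n / o) := by
  rcases Nat.eq_zero_or_pos o with rfl | ho
  · simp
  have ho' : (0 : ℝ) < o := by exact_mod_cast ho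
  have hon' : (o : ℝ) ≤ n := by exact_mod_cast hon
  refine Real.log_nonneg ?_
  rw [one_le_div ho']
  nlinarith [Real.add_one_le_exp (1 : ℝ)]

theorem one_le_log_exp_one_mul (hp : 0 < p) : 1 ≤ Real.log (Real.exp 1 * p) := by
  have hp' : (1 : ℝ) ≤ p := by exact_mod_cast hp
  rw [Real.log_mul (Real.exp_pos 1).ne' (by linarith), Real.log_exp]
  linarith [Real.log_nonneg hp']

/-- The oracle inequality with the stochastic term bounded by `noiseExcess`. -/
theorem norm_sq_le_noiseExcess {l : EuclideanSpace ℝ (Fin n) → ℝ} (hl : OneSmooth l)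
    {X : Matrix (Fin n) (Fin p) ℝ} {βs βh : EuclideanSpace ℝ (Fin p)}
    {γs γh : EuclideanSpace ℝ (Fin n)} {σ A lam ρ θ ε δ K b : ℝ} {q : ℕ} (hp : 0 < p)
    (hσ : 0 < σ) (hA : 0 < A) (hlam : lam = A * σ * √(Real.log (Real.exp 1 * p)))
    (hρ : 0 < ρ) (hX : spectralNorm X ≤ ρ) (hθ : 1 ≤ θ) (hq : (q : ℝ) = θ * l0norm γs)
    (hδ : 0 < δ) (hb : 0 < b) (hb4 : b ≤ 1 / 4) (hbδ : b ≤ δ / 16) (hbε : b * (2 + ε) ≤ ε)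
    (hAb : 12 ≤ A * b)
    (hcond : GeneralCondition l X βs (l0norm γs) lam ρ θ ε δ K)
    (hest : IsAEstimator l X lam ρ q βh γh) :
    ‖sysComp X (βh - βs) (γh - γs)‖ ^ 2 ≤
      1024 / δ ^ 2 * σ ^ 2 * (4 * θ * l0norm γs * Real.log (Real.exp 1 * n / l0norm γs)) +
        8 / δ * (K ^ 2 * (A ^ 2 * σ ^ 2 * Real.log (Real.exp 1 * p)) * l0norm βs) +
        1024 / δ ^ 2 * σ ^ 2 * noiseExcess X σ (Real.log (Real.exp 1 * p))
          (2 * ((q + l0norm γs : ℕ) : ℝ) * Real.log (Real.exp 1 * n / l0norm γs)) (q + l0norm γs)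
          (effectiveNoise l X βs γs) := by
  set L := Real.log (Real.exp 1 * p) with hL
  set o := l0norm γs with ho
  set Λ := Real.log (Real.exp 1 * n / o) with hΛ
  set R := 2 * ((q + o : ℕ) : ℝ) * Λ with hR
  set e := effectiveNoise l X βs γs with he
  set W := noiseExcess X σ L R (q + o) e with hW
  have hon : o ≤ n := by
    rw [ho, l0norm_eq_card_supp]
    simpa using Finset.card_le_univ (supp γs)
  have hΛ0 : 0 ≤ Λ := log_exp_one_mul_div_nonneg hon
  have hL1 : 1 ≤ L := one_le_log_exp_one_mul hp
  have hlam2 : lam ^ 2 = A ^ 2 * σ ^ 2 * L := by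
    rw [hlam, mul_pow, Real.sq_sqrt (by linarith), mul_pow]
  have hlam0 : 0 < lam := by
    rw [hlam]
    exact mul_pos (mul_pos hA hσ) (Real.sqrt_pos.2 (by linarith))
  -- The threshold `b * lam` is a fixed fraction of the penalty level, so the residual noise fits
  -- into the `ℓ¹` term.
  obtain ⟨S, hS, hinner⟩ := exists_modelSpace_inner_le hρ hX (mul_pos hb hlam0).le
    (supp (γh - γs)) e
  set ζ := ‖(modelSpace X S (supp (γh - γs))).starProjection e‖ with hζ
  have hT : (supp (γh - γs)).card ≤ q + o := by
    rw [← l0norm_eq_card_supp]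
    exact (l0norm_sub_le γh γs).trans (Nat.add_le_add_right hest.2.1 _)
  have hζle : ζ ^ 2 ≤ 32 * σ ^ 2 * (2 * S.card * L + R + W) :=
    norm_starProjection_sq_le_noiseExcess X hσ L R e S hT
  -- Since `12² ≥ 128`, the term `64 σ² L |S|` in the bound of `ζ²` is at most `ζ² / 2` and is
  -- absorbed, at the price of doubling 32 to 64.
  have hκ : 128 * σ ^ 2 * L * S.card ≤ (b * lam) ^ 2 * S.card := by
    have h128 : 128 ≤ (A * b) ^ 2 := by nlinarith
    rw [mul_pow, hlam2, show b ^ 2 * (A ^ 2 * σ ^ 2 * L) = (A * b) ^ 2 * σ ^ 2 * L by ring]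
    gcongr
  have hζ2 : ζ ^ 2 ≤ 64 * σ ^ 2 * (R + W) := by linarith
  have hRle : R ≤ 4 * θ * o * Λ := by
    have : ((q + o : ℕ) : ℝ) ≤ 2 * θ * o := by
      rw [Nat.cast_add, hq]
      nlinarith [(Nat.cast_nonneg o : (0 : ℝ) ≤ o)]
    nlinarith
  have hmain := norm_sq_le_of_inner_noise_le hl hlam0 hρ hθ hq hδ hb hb4 hbδ hbε hcond hest
    (hinner _ _ subset_rfl)
  rw [← l0norm_eq_card_supp, hlam2] at hmain
  calc _ ≤ _ := hmain
    _ ≤ 16 / δ ^ 2 * (64 * σ ^ 2 * (4 * θ * o * Λ + W)) +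
          8 / δ * (K ^ 2 * (A ^ 2 * σ ^ 2 * L) * l0norm βs) := by
        have : ζ ^ 2 ≤ 64 * σ ^ 2 * (4 * θ * o * Λ + W) := hζ2.trans (by gcongr)
        gcongr
    _ = _ := by ring

/-- The risk bound for A-estimators of a loss with a `1`-Lipschitz gradient. -/
theorem risk_bound_of_generalCondition {ε δ : ℝ} (hε : 0 < ε) (hδ : 0 < δ) :
    ∃ A₀ : ℝ, 0 < A₀ ∧ ∀ A : ℝ, A₀ ≤ A → ∃ C : ℝ, 0 < C ∧
      ∀ (n p : ℕ), 0 < n → 0 < p →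
      ∀ (X : Matrix (Fin n) (Fin p) ℝ)
        (βs : EuclideanSpace ℝ (Fin p)) (γs : EuclideanSpace ℝ (Fin n))
        (σ lam ρ θ K : ℝ) (q : ℕ),
        0 < σ → lam = A * σ * √(Real.log (Real.exp 1 * p)) →
        0 < ρ → spectralNorm X ≤ ρ →
        1 ≤ θ → (q : ℝ) = θ * l0norm γs → 0 ≤ K →
      ∀ (𝒴 : Type*) (l : EuclideanSpace ℝ (Fin n) → 𝒴 → ℝ)
        (Ω : Type*) [MeasurableSpace Ω] (μ : Measure Ω) [IsProbabilityMeasure μ] (y : Ω → 𝒴),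
        (∀ᵐ ω ∂μ, OneSmooth (fun η => l η (y ω))) →
        (∀ᵐ ω ∂μ, GeneralCondition (fun η => l η (y ω)) X βs (l0norm γs) lam ρ θ ε δ K) →
        IsSubGaussianVec (fun ω => effectiveNoise (fun η => l η (y ω)) X βs γs) σ μ →
      ∀ (βh : Ω → EuclideanSpace ℝ (Fin p)) (γh : Ω → EuclideanSpace ℝ (Fin n)),
        AEMeasurable βh μ → AEMeasurable γh μ →
        (∀ᵐ ω ∂μ, IsAEstimator (fun η => l η (y ω)) X lam ρ q (βh ω) (γh ω)) →
        Integrable (fun ω => ‖sysComp X (βh ω - βs) (γh ω - γs)‖ ^ 2) μ ∧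
        ∫ ω, ‖sysComp X (βh ω - βs) (γh ω - γs)‖ ^ 2 ∂μ ≤
          C * rate n p (l0norm γs) (l0norm βs) σ θ K := by
  obtain ⟨b, hb, hb4, hbδ, hbε⟩ : ∃ b : ℝ, 0 < b ∧ b ≤ 1 / 4 ∧ b ≤ δ / 16 ∧ b * (2 + ε) ≤ ε := by
    refine ⟨min (1 / 4) (min (δ / 16) (ε / (2 + ε))), by positivity, min_le_left _ _,
      (min_le_right _ _).trans (min_le_left _ _), ?_⟩
    rw [← le_div_iff₀ (by positivity)]
    exact (min_le_right _ _).trans (min_le_right _ _)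
  -- The constant 4096 is `1024 * 4` from the outlier term and also covers `1024 * 3` from the mean
  -- of the excess; `8 / δ * A²` comes from `lam²`.
  refine ⟨12 / b, by positivity, fun A hA => ⟨4096 / δ ^ 2 + 8 / δ * A ^ 2, by positivity, ?_⟩⟩
  intro n p hn hp X βs γs σ lam ρ θ K q hσ hlam hρ hX hθ hq hK 𝒴 l Ω _ μ _ y hl hcond hsub βh γh
    hβm hγm hest
  have hA0 : 0 < A := lt_of_lt_of_le (by positivity) hA
  have hAb : 12 ≤ A * b := (div_le_iff₀ hb).1 hA
  set L := Real.log (Real.exp 1 * p) with hL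
  set Λ := Real.log (Real.exp 1 * n / l0norm γs) with hΛ
  set e := fun ω => effectiveNoise (fun η => l η (y ω)) X βs γs with he
  set R := 2 * ((q + l0norm γs : ℕ) : ℝ) * Λ with hR
  set W := fun ω => noiseExcess X σ L R (q + l0norm γs) (e ω) with hW
  set D := 1024 / δ ^ 2 * σ ^ 2 * (4 * θ * l0norm γs * Λ) +
    8 / δ * (K ^ 2 * (A ^ 2 * σ ^ 2 * L) * l0norm βs) with hD
  have hon : l0norm γs ≤ n := by
    rw [l0norm_eq_card_supp]
    simpa using Finset.card_le_univ (supp γs)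
  have hΛ0 : 0 ≤ Λ := log_exp_one_mul_div_nonneg hon
  have hL1 : 1 ≤ L := one_le_log_exp_one_mul hp
  have hWm : AEMeasurable W μ := aemeasurable_noiseExcess hsub X L R _
  have hW0 : ∀ ω, 0 ≤ W ω := fun ω => noiseExcess_nonneg X σ L R _ (e ω)
  have hWle : ∫⁻ ω, ENNReal.ofReal (W ω) ∂μ ≤ ENNReal.ofReal 3 :=
    lintegral_noiseExcess_le hσ hsub X hp hon (Nat.le_add_left _ _) fun h0 => by
      rw [h0, Nat.cast_zero, mul_zero, Nat.cast_eq_zero] at hq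
      omega
  have hWi : Integrable W μ := by
    refine ⟨hWm.aestronglyMeasurable, ?_⟩
    rw [hasFiniteIntegral_iff_ofReal (Filter.Eventually.of_forall hW0)]
    exact lt_of_le_of_lt hWle ENNReal.ofReal_lt_top
  have hW3 : ∫ ω, W ω ∂μ ≤ 3 := by
    rw [integral_eq_lintegral_of_nonneg_ae (Filter.Eventually.of_forall hW0)
      hWm.aestronglyMeasurable]
    exact ENNReal.toReal_le_of_le_ofReal (by norm_num) hWle
  have hbound : ∀ᵐ ω ∂μ, ‖sysComp X (βh ω - βs) (γh ω - γs)‖ ^ 2 ≤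
      D + 1024 / δ ^ 2 * σ ^ 2 * W ω := by
    filter_upwards [hl, hcond, hest] with ω h1 h2 h3
    exact norm_sq_le_noiseExcess h1 hp hσ hA0 hlam hρ hX hθ hq hδ hb hb4 hbδ hbε hAb h2 h3
  have hdom : Integrable (fun ω => D + 1024 / δ ^ 2 * σ ^ 2 * W ω) μ :=
    (integrable_const _).add (hWi.const_mul _)
  have hFm : AEStronglyMeasurable (fun ω => ‖sysComp X (βh ω - βs) (γh ω - γs)‖ ^ 2) μ := by
    have hlin : Measurable (Matrix.toEuclideanLin X) :=
      (Matrix.toEuclideanLin X).continuous_of_finiteDimensional.measurable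
    exact (((hlin.comp_aemeasurable (hβm.sub_const βs)).add
      (hγm.sub_const γs)).norm.pow_const 2).aestronglyMeasurable
  have hFi : Integrable (fun ω => ‖sysComp X (βh ω - βs) (γh ω - γs)‖ ^ 2) μ := by
    refine hdom.mono' hFm ?_
    filter_upwards [hbound] with ω h
    rwa [Real.norm_of_nonneg (sq_nonneg _)]
  refine ⟨hFi, ?_⟩
  calc ∫ ω, ‖sysComp X (βh ω - βs) (γh ω - γs)‖ ^ 2 ∂μ
      ≤ ∫ ω, D + 1024 / δ ^ 2 * σ ^ 2 * W ω ∂μ := integral_mono_ae hFi hdom hbound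
    _ = D + 1024 / δ ^ 2 * σ ^ 2 * ∫ ω, W ω ∂μ := by
        rw [integral_add (integrable_const _) (hWi.const_mul _), integral_const_mul]
        simp
    _ ≤ D + 1024 / δ ^ 2 * σ ^ 2 * 3 := by gcongr
    _ ≤ (4096 / δ ^ 2 + 8 / δ * A ^ 2) * rate n p (l0norm γs) (l0norm βs) σ θ K := by
        have hθ0 : 0 ≤ θ := by linarith
        have ha : 0 ≤ σ ^ 2 * θ * l0norm γs * Λ := by positivity
        have hs : 0 ≤ K ^ 2 * σ ^ 2 * l0norm βs * L := by positivity
        have h1 : 0 ≤ 4096 / δ ^ 2 * (K ^ 2 * σ ^ 2 * l0norm βs * L) := by positivity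
        have h2 : 0 ≤ 8 / δ * A ^ 2 * (σ ^ 2 * θ * l0norm γs * Λ + σ ^ 2) := by positivity
        have h3 : 0 ≤ 1 / δ ^ 2 * σ ^ 2 := by positivity
        rw [rate, ← hL, ← hΛ, hD]
        linear_combination h1 + h2 + 1024 * h3

/-- For the squared loss, twice the symmetrized Bregman function is the squared distance, so the
condition depends only on differences. The product in the first lasso condition splits as `N² / 4 +
K² lam² J`; keeping `N² / 4` out of `(1 - δ / 2) N²` requires `δ ≤ 3/2`, hence the cap. -/
theorem generalCondition_sqLoss {X : Matrix (Fin n) (Fin p) ℝ} {βs : EuclideanSpace ℝ (Fin p)}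
    {o : ℕ} {lam ρ θ ε δ K : ℝ} (hlam : 0 < lam)
    (h : LassoCondition X βs o lam ρ θ ε K ∨ LassoQuadCondition X βs o lam ρ θ ε δ K)
    (y : EuclideanSpace ℝ (Fin n)) :
    GeneralCondition (fun η => sqLoss η y) X βs o lam ρ θ ε (min δ (3 / 2)) K := by
  intro β β' γ γ' hγ hγ'
  have hsparse : (l0norm (γ - γ') : ℝ) ≤ (1 + θ) * o := by
    have h1 : (l0norm (γ - γ') : ℝ) ≤ l0norm γ + l0norm γ' := by
      exact_mod_cast l0norm_sub_le γ γ'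
    have h2 : (l0norm γ' : ℝ) ≤ o := by exact_mod_cast hγ'
    linarith
  rw [two_mul_symBreg_sqLoss, breg2, sysComp_sub]
  set N := ‖sysComp X (β - β') (γ - γ')‖ with hN
  have hN2 := sq_nonneg N
  rcases h with h | h
  · have h1 := mul_le_mul_of_nonneg_left (h (β - β') (γ - γ') hsparse) hlam.le
    simp only [PiLp.sub_apply] at h1
    rw [← hN] at h1
    have e1 : lam * (‖γ - γ'‖ ^ 2 / (2 * lam * √θ) +
        (1 + ε) * ρ * ∑ j ∈ supp βs, |β j - β' j|) = ‖γ - γ'‖ ^ 2 / (2 * √θ) +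
        (1 + ε) * lam * ρ * ∑ j ∈ supp βs, |β j - β' j| := by
      rw [mul_add, mul_div_assoc', show 2 * lam * √θ = lam * (2 * √θ) by ring,
        mul_div_mul_left _ _ hlam.ne']
      ring
    have h2 : lam * (K * √((supp βs).card : ℝ) * N) ≤
        N ^ 2 / 4 + K ^ 2 * lam ^ 2 * (supp βs).card := by
      have hs : √((supp βs).card : ℝ) ^ 2 = (supp βs).card := Real.sq_sqrt (Nat.cast_nonneg _)
      have := sq_nonneg (N / 2 - K * lam * √((supp βs).card : ℝ))
      rw [sub_sq, mul_pow (K * lam), hs] at this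
      linarith
    have h3 := mul_le_mul_of_nonneg_right (min_le_right δ (3 / 2)) hN2
    rw [e1] at h1
    linarith
  · have h1 := h (β - β') (γ - γ') hsparse
    simp only [PiLp.sub_apply] at h1
    rw [← hN] at h1
    have h3 := mul_le_mul_of_nonneg_right (min_le_left δ (3 / 2)) hN2
    linarith

end Risk

end ResistantLasso

theorem theorem5 :
    -- the resistant lasso
    (∀ ε δ : ℝ, 0 < ε → 0 < δ → ∃ A₀ : ℝ, 0 < A₀ ∧ ∀ A : ℝ, A₀ ≤ A → ∃ C : ℝ, 0 < C ∧
      ∀ (n p : ℕ), 0 < n → 0 < p →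
      ∀ (X : Matrix (Fin n) (Fin p) ℝ)
        (βs : EuclideanSpace ℝ (Fin p)) (γs : EuclideanSpace ℝ (Fin n))
        (σ lam ρ θ K : ℝ) (q : ℕ),
        0 < σ → lam = A * σ * √(Real.log (Real.exp 1 * p)) →
        0 < ρ → ResistantLasso.spectralNorm X ≤ ρ →
        1 ≤ θ → (q : ℝ) = θ * ResistantLasso.l0norm γs → 0 ≤ K →
        (ResistantLasso.LassoCondition X βs (ResistantLasso.l0norm γs) lam ρ θ ε K ∨
          ResistantLasso.LassoQuadCondition X βs (ResistantLasso.l0norm γs) lam ρ θ ε δ K) →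
      ∀ (Ω : Type*) [MeasurableSpace Ω] (μ : Measure Ω) [IsProbabilityMeasure μ]
        (y : Ω → EuclideanSpace ℝ (Fin n)),
        ResistantLasso.IsSubGaussianVec (fun ω =>
          ResistantLasso.effectiveNoise (fun η => ResistantLasso.sqLoss η (y ω)) X βs γs) σ μ →
      ∀ (βh : Ω → EuclideanSpace ℝ (Fin p)) (γh : Ω → EuclideanSpace ℝ (Fin n)),
        AEMeasurable βh μ → AEMeasurable γh μ →
        (∀ᵐ ω ∂μ, ResistantLasso.IsAEstimator (fun η => ResistantLasso.sqLoss η (y ω))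
          X lam ρ q (βh ω) (γh ω)) →
        Integrable (fun ω => ‖ResistantLasso.sysComp X (βh ω - βs) (γh ω - γs)‖ ^ 2) μ ∧
        ∫ ω, ‖ResistantLasso.sysComp X (βh ω - βs) (γh ω - γs)‖ ^ 2 ∂μ ≤
          C * ResistantLasso.rate n p (ResistantLasso.l0norm γs) (ResistantLasso.l0norm βs)
            σ θ K) ∧
    -- a general loss with 1-Lipschitz gradient
    (∀ ε δ : ℝ, 0 < ε → 0 < δ → ∃ A₀ : ℝ, 0 < A₀ ∧ ∀ A : ℝ, A₀ ≤ A → ∃ C : ℝ, 0 < C ∧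
      ∀ (n p : ℕ), 0 < n → 0 < p →
      ∀ (X : Matrix (Fin n) (Fin p) ℝ)
        (βs : EuclideanSpace ℝ (Fin p)) (γs : EuclideanSpace ℝ (Fin n))
        (σ lam ρ θ K : ℝ) (q : ℕ),
        0 < σ → lam = A * σ * √(Real.log (Real.exp 1 * p)) →
        0 < ρ → ResistantLasso.spectralNorm X ≤ ρ →
        1 ≤ θ → (q : ℝ) = θ * ResistantLasso.l0norm γs → 0 ≤ K →
      ∀ (𝒴 : Type*) (l : EuclideanSpace ℝ (Fin n) → 𝒴 → ℝ)
        (Ω : Type*) [MeasurableSpace Ω] (μ : Measure Ω) [IsProbabilityMeasure μ] (y : Ω → 𝒴),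
        (∀ᵐ ω ∂μ, ResistantLasso.OneSmooth (fun η => l η (y ω))) →
        (∀ᵐ ω ∂μ, ResistantLasso.GeneralCondition (fun η => l η (y ω)) X βs
          (ResistantLasso.l0norm γs) lam ρ θ ε δ K) →
        ResistantLasso.IsSubGaussianVec (fun ω =>
          ResistantLasso.effectiveNoise (fun η => l η (y ω)) X βs γs) σ μ →
      ∀ (βh : Ω → EuclideanSpace ℝ (Fin p)) (γh : Ω → EuclideanSpace ℝ (Fin n)),
        AEMeasurable βh μ → AEMeasurable γh μ →
        (∀ᵐ ω ∂μ, ResistantLasso.IsAEstimator (fun η => l η (y ω))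
          X lam ρ q (βh ω) (γh ω)) →
        Integrable (fun ω => ‖ResistantLasso.sysComp X (βh ω - βs) (γh ω - γs)‖ ^ 2) μ ∧
        ∫ ω, ‖ResistantLasso.sysComp X (βh ω - βs) (γh ω - γs)‖ ^ 2 ∂μ ≤
          C * ResistantLasso.rate n p (ResistantLasso.l0norm γs) (ResistantLasso.l0norm βs)
            σ θ K) := by
  refine ⟨fun ε δ hε hδ => ?_, fun ε δ hε hδ =>
    ResistantLasso.risk_bound_of_generalCondition hε hδ⟩
  -- The capped value of `δ` lets a single choice of constants serve both lasso conditions.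
  obtain ⟨A₀, hA₀, H⟩ := ResistantLasso.risk_bound_of_generalCondition hε
    (lt_min hδ (by norm_num : (0 : ℝ) < 3 / 2))
  refine ⟨A₀, hA₀, fun A hA => ?_⟩
  obtain ⟨C, hC, H⟩ := H A hA
  refine ⟨C, hC, ?_⟩
  intro n p hn hp X βs γs σ lam ρ θ K q hσ hlam hρ hX hθ hq hK hcond Ω _ μ _ y hsub βh γh
    hβm hγm hest
  have hlam0 : 0 < lam := by
    rw [hlam]
    exact mul_pos (mul_pos (hA₀.trans_le hA) hσ)
      (Real.sqrt_pos.2 (one_pos.trans_le (ResistantLasso.one_le_log_exp_one_mul hp)))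
  exact H n p hn hp X βs γs σ lam ρ θ K q hσ hlam hρ hX hθ hq hK _ ResistantLasso.sqLoss Ω μ y
    (Filter.Eventually.of_forall fun ω => ResistantLasso.oneSmooth_sqLoss (y ω))
    (Filter.Eventually.of_forall fun ω => ResistantLasso.generalCondition_sqLoss hlam0 hcond (y ω))
    hsub βh γh hβm hγm hest
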